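/- **Conventions.** A simplicial complex is a finite set $\Delta$ of finite sets (faces, including $\emptyset$) closed under taking subsets; $f_{i-1}(\Delta)$ is the number of faces with $i$ elements, and if $\dim\Delta=d-1$ then $h(\Delta)=(h_0,\dots,h_d)$ with $h_j=\sum_{i=0}^{j}(-1)^{j-i}\binom{d-i}{d-j}f_{i-1}(\Delta)$. Write $\sigma^k$ for the $k$-simplex, $\partial\sigma^k$ for its boundary ($\partial\sigma^0=\{\emptyset\}$) and $*$ for the join. A PS sphere is a join of simplex boundaries; a PS ball is a join $\sigma*\Sigma$ of a nonempty simplex and a PS sphere, with boundary $\partial\sigma*\Sigma$. A PS ear-decomposition of a pure $(d-1)$-dimensional complex $\Delta$ is $\Delta=\Sigma_0\cup\cdots\cup\Sigma_t$ with $\Sigma_0$ a PS $(d-1)$-sphere, each $\Sigma_j$ ($1\le j\le t$) a PS $(d-1)$-ball, and $\Sigma_j\cap\bigcup_{i<j}\Sigma_i=\partial\Sigma_j$. For $d=3$ the ears $\sigma^0*\partial\sigma^2$, $\sigma^0*\partial\sigma^1*\partial\sigma^1$, $\sigma^1*\partial\sigma^1$, $\sigma^2$ are said to be of type A, B, E,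 F, and $\eta_A,\eta_B,\eta_E,\eta_F$ are the numbers of ears of each type. A multicomplex is a nonempty finite set $\mathcal M$ of monomials closed under divisibility; it is pure if all its maximal monomials under divisibility have the same degree. Its $F$-vector is $F(\mathcal M)=(F_0,\dots,F_d)$, where $F_i$ counts its monomials of degree $i$ and $d$ is their maximal degree. A pure $\mathcal O$-sequence is the $F$-vector of a pure multicomplex. Revlex order on monomials: $\mu<\nu$ if $\mu$ has the smaller exponent at the largest index where their exponents differ; for sets of vertices $v_i$, apply this to the squarefree monomials $\prod x_i$. A missing face of a complex is a non-face all of whose proper subsets are faces. **Algorithm** (input $\eta_A,\eta_B,\eta_E,\eta_F$; it builds a complex $\mathcal C(\Delta)$ and a set of monomials $\mathcal M(\Delta)$). * Step 0. Start with the boundary of the tetrahedron $v_1v_2v_3v_4$ and with $\{1,x_4,x_4^2,x_4^3\}$. * Step 1. For $5\le i\le\eta_B+4$, add the cone from the new vertex $v_i$ over the cycle $v_1v_2v_3v_4$, and the monomials $x_i,\,x_4x_i,\,x_i^2,\,x_4x_i^2$. For $\eta_B+5\le i\le\eta_A+\eta_B+4$, add the cone from the new vertex $v_i$ over the cycle $v_1v_2v_3$,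 and the monomials $x_i,\,x_i^2,\,x_i^3$. * Step 2. Repeat $\eta_E$ times: let $\{v_i,v_j\}$, $i<j$, be the revlex smallest missing edge; add the triangles $\{v_1,v_i,v_j\}$ and $\{v_2,v_i,v_j\}$ with all their faces, and the monomials $x_ix_j,\,x_i^2x_j$. * Step 3. Repeat $\eta_F$ times: add the revlex smallest missing face with three vertices, and the revlex smallest monomial of degree $3$ that is not yet present but all of whose proper divisors are. **Theorem.** Let $\Delta$ be a $2$-dimensional simplicial complex with a PS ear-decomposition $\Sigma_0\cup\cdots\cup\Sigma_t$ such that $\Sigma_0=\partial\sigma^3$ is the boundary of a tetrahedron, and let $\eta_A,\eta_B,\eta_E,\eta_F$ be its numbers of ears of each type. Then the algorithm, run on these numbers, can carry out all of its steps, so that it has a (unique) output $(\mathcal C(\Delta),\mathcal M(\Delta))$. The complex $\mathcal C(\Delta)$ has a PS ear-decomposition with base sphere $\partial\sigma^3$ and with the same number of ears of each type. The set $\mathcal M(\Delta)$ is a pure multicomplex, and $$F(\mathcal M(\Delta))=h(\mathcal C(\Delta))=h(\Delta).$$ Consequently $h(\Delta)$ is a pure $\mathcal O$-sequence. -/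

import Mathlib

namespace PSEar

section Complexes

variable {V : Type*} [DecidableEq V]

/-- Finite simplicial complexes are represented by their finite set of faces, the empty face
included (Mathlib's `PreAbstractSimplicialComplex` leaves it out, but joins and `f_{-1}` need it).
This predicate is closure under taking subsets. -/
def IsComplex (Δ : Finset (Finset V)) : Prop :=
  IsLowerSet (Δ : Set (Finset V))

/-- The dimension plus one: the maximal number of vertices of a face. -/
def rank (Δ : Finset (Finset V)) : ℕ :=
  Δ.sup Finset.card

/-- `Δ` is a pure simplicial complex of dimension `d - 1`: all facets have `d` vertices. -/
def IsPureComplex (d : ℕ) (Δ : Finset (Finset V)) : Prop :=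
  IsComplex Δ ∧ Δ.Nonempty ∧ ∀ F, Maximal (· ∈ Δ) F → F.card = d

/-- `fNum Δ i` is the number of faces with `i` vertices, that is `f_{i-1}(Δ)`. -/
def fNum (Δ : Finset (Finset V)) (i : ℕ) : ℕ :=
  (Δ.filter fun F => F.card = i).card

/-- `h_j` of a complex of dimension `d - 1`. -/
def hNum (d : ℕ) (Δ : Finset (Finset V)) (j : ℕ) : ℤ :=
  ∑ i ∈ Finset.range (j + 1), (-1) ^ (j - i) * ((d - i).choose (d - j) : ℤ) * (fNum Δ i : ℤ)

/-- The `h`-vector `(h_0, ..., h_d)` of `Δ`, where `d = dim Δ + 1`. -/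
def hVector (Δ : Finset (Finset V)) : List ℤ :=
  (List.range (rank Δ + 1)).map (hNum (rank Δ) Δ)

/-- The join of two complexes (used for complexes on disjoint vertex sets). -/
def join (Γ Λ : Finset (Finset V)) : Finset (Finset V) :=
  Finset.image₂ (· ∪ ·) Γ Λ

/-- The join `∂S₁ * ... * ∂Sₖ` of the boundaries of the simplices with vertex sets `Sᵢ`;
the empty join is `{∅}`. -/
def boundaryJoin : List (Finset V) → Finset (Finset V)
  | [] => {∅}
  | S :: L => join S.ssubsets (boundaryJoin L)

/-- `Γ = ∂σ^{d₁} * ... * ∂σ^{dₖ}`, where `dims = [d₁, ..., dₖ]`. -/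
def IsSphereOfType (dims : List ℕ) (Γ : Finset (Finset V)) : Prop :=
  ∃ L : List (Finset V), L.map Finset.card = dims.map (· + 1) ∧ L.Pairwise Disjoint ∧
    Γ = boundaryJoin L

/-- `B = σ^k * ∂σ^{d₁} * ... * ∂σ^{dₖ}`, where `dims = [d₁, ..., dₖ]`, and `bd` is the boundary
complex `∂σ^k * ∂σ^{d₁} * ... * ∂σ^{dₖ}` of this ball. -/
def IsBallOfType (k : ℕ) (dims : List ℕ) (B bd : Finset (Finset V)) : Prop :=
  ∃ (S : Finset V) (L : List (Finset V)), S.card = k + 1 ∧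
    L.map Finset.card = dims.map (· + 1) ∧ (S :: L).Pairwise Disjoint ∧
    B = join S.powerset (boundaryJoin L) ∧ bd = join S.ssubsets (boundaryJoin L)

/-- PS spheres of dimension `d - 1`: joins of simplex boundaries. -/
def IsPSSphere (d : ℕ) (Γ : Finset (Finset V)) : Prop :=
  rank Γ = d ∧ ∃ dims, IsSphereOfType dims Γ

/-- PS balls of dimension `d - 1` with boundary `bd`: joins of a simplex and a PS sphere. -/
def IsPSBall (d : ℕ) (B bd : Finset (Finset V)) : Prop :=
  rank B = d ∧ ∃ k dims, IsBallOfType k dims B bd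

/-- `Δ = Σ₀ ∪ Σ₁ ∪ ... ∪ Σₜ` is a PS ear-decomposition of the pure `(d-1)`-dimensional complex
`Δ`; here `Σⱼ` is `P j` for `j ≤ t`. -/
structure IsPSEarDecomposition (d : ℕ) (Δ : Finset (Finset V)) (t : ℕ)
    (P : ℕ → Finset (Finset V)) : Prop where
  pure : IsPureComplex d Δ
  union : Δ = (Finset.range (t + 1)).biUnion P
  sphere : IsPSSphere d (P 0)
  ear : ∀ j, 1 ≤ j → j ≤ t →
    ∃ bd, IsPSBall d (P j) bd ∧ P j ∩ (Finset.range j).biUnion P = bd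

/-- The four types of ears (PS balls) in dimension 2. -/
inductive EarType
  | A
  | B
  | E
  | F

/-- A: `σ^0 * ∂σ^2`, B: `σ^0 * ∂σ^1 * ∂σ^1`, E: `σ^1 * ∂σ^1`, F: `σ^2`. -/
def IsEar : EarType → Finset (Finset V) → Prop
  | .A, B => ∃ bd, IsBallOfType 0 [2] B bd
  | .B, B => ∃ bd, IsBallOfType 0 [1, 1] B bd
  | .E, B => ∃ bd, IsBallOfType 1 [1] B bd
  | .F, B => ∃ bd, IsBallOfType 2 [] B bd

open Classical in
/-- The number of ears of the given type among `P 1, ..., P t`. -/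
noncomputable def earCount (t : ℕ) (P : ℕ → Finset (Finset V)) (τ : EarType) : ℕ :=
  ((Finset.Icc 1 t).filter fun j => IsEar τ (P j)).card

end Complexes

section Multicomplexes

variable {X : Type*}

/-- A monomial in variables indexed by `X` is the multiset of its variables (with multiplicity):
divisibility is `≤` and the degree is `Multiset.card`. A multicomplex is a nonempty finite set of
monomials closed under divisibility. -/
def IsMulticomplex (M : Finset (Multiset X)) : Prop :=
  M.Nonempty ∧ IsLowerSet (M : Set (Multiset X))

/-- A multicomplex all of whose maximal monomials have the same degree. -/
def IsPureMulticomplex (M : Finset (Multiset X)) : Prop :=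
  IsMulticomplex M ∧ ∃ d, ∀ μ, Maximal (· ∈ M) μ → Multiset.card μ = d

/-- The vector `(F_0, ..., F_d)`, where `F_i` is the number of monomials of degree `i` in `M` and
`d` is the maximal degree of a monomial in `M`. -/
def FVector (M : Finset (Multiset X)) : List ℤ :=
  (List.range (M.sup Multiset.card + 1)).map
    fun i => ((M.filter fun μ => Multiset.card μ = i).card : ℤ)

/-- `F`-vectors of pure multicomplexes. (As a multicomplex is finite, a countable supply of
variables suffices.) -/
def IsPureOSequence (F : List ℤ) : Prop :=
  ∃ M : Finset (Multiset ℕ), IsPureMulticomplex M ∧ FVector M = F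

end Multicomplexes

section Algorithm

/-- Reverse lexicographic order on monomials in `x_0, x_1, ...`: at the largest index where the
exponents differ, the smaller monomial has the smaller exponent. Applied to `S.val` for finite sets
`S`, this is the order used in the Kruskal-Katona theorem. -/
def RevlexLT (μ ν : Multiset ℕ) : Prop :=
  ∃ k, μ.count k < ν.count k ∧ ∀ l, k < l → μ.count l = ν.count l

/-- `G` is a missing face of `C`: a non-face all of whose proper subsets are faces. -/
def IsMissingFace (C : Finset (Finset ℕ)) (G : Finset ℕ) : Prop :=
  G ∉ C ∧ ∀ H, H ⊂ G → H ∈ C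

/-- `G` is the revlex smallest missing face with `m` vertices. -/
def IsLeastMissingFace (C : Finset (Finset ℕ)) (m : ℕ) (G : Finset ℕ) : Prop :=
  (G.card = m ∧ IsMissingFace C G) ∧
    ∀ G' : Finset ℕ, G'.card = m → IsMissingFace C G' → G' ≠ G → RevlexLT G.val G'.val

/-- `μ` is a monomial outside `M` all of whose proper divisors belong to `M`. -/
def IsAvailable (M : Finset (Multiset ℕ)) (μ : Multiset ℕ) : Prop :=
  μ ∉ M ∧ ∀ ν, ν < μ → ν ∈ M

/-- `μ` is the revlex smallest available monomial of degree `m`. -/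
def IsLeastAvailable (M : Finset (Multiset ℕ)) (m : ℕ) (μ : Multiset ℕ) : Prop :=
  (Multiset.card μ = m ∧ IsAvailable M μ) ∧
    ∀ ν : Multiset ℕ, Multiset.card ν = m → IsAvailable M ν → ν ≠ μ → RevlexLT μ ν

/-- The current complex, with the vertex `v_i` written as `i`, and the current set of monomials,
with the variable `x_i` written as `i`. -/
structure State where
  complex : Finset (Finset ℕ)
  monomials : Finset (Multiset ℕ)

/-- The state after Steps 0 and 1, for `a` ears of type A and `b` ears of type B: start with the
boundary of the tetrahedron `v_1 v_2 v_3 v_4` and `1, x_4, x_4^2, x_4^3`; for `5 ≤ i ≤ b + 4` add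
the cone from `v_i` over the cycle `v_1 v_2 v_3 v_4` and `x_i, x_4 x_i, x_i^2, x_4 x_i^2`; for
`b + 5 ≤ i ≤ a + b + 4` add the cone from `v_i` over the cycle `v_1 v_2 v_3` and
`x_i, x_i^2, x_i^3`. -/
def initialState (a b : ℕ) : State where
  complex :=
    boundaryJoin [{1, 2, 3, 4}] ∪
      (Finset.Icc 5 (b + 4)).biUnion
        (fun i => join (Finset.powerset {i}) (boundaryJoin [{1, 3}, {2, 4}])) ∪
      (Finset.Icc (b + 5) (a + b + 4)).biUnion
        (fun i => join (Finset.powerset {i}) (boundaryJoin [{1, 2, 3}]))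
  monomials :=
    {0, {4}, {4, 4}, {4, 4, 4}} ∪
      (Finset.Icc 5 (b + 4)).biUnion (fun i => {{i}, {4, i}, {i, i}, {4, i, i}}) ∪
      (Finset.Icc (b + 5) (a + b + 4)).biUnion (fun i => {{i}, {i, i}, {i, i, i}})

/-- One iteration of Step 2: take the revlex smallest missing edge `v_i v_j` with `i < j`, add the
two triangles `v_1 v_i v_j` and `v_2 v_i v_j` with their faces (the ear of type E with boundary
the cycle `v_1 v_i v_2 v_j`), and add `x_i x_j` and `x_i^2 x_j`. -/
def EStep (s s' : State) : Prop :=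
  ∃ i j : ℕ, i < j ∧ IsLeastMissingFace s.complex 2 {i, j} ∧
    s'.complex = s.complex ∪ join (Finset.powerset {i, j}) (boundaryJoin [{1, 2}]) ∧
    s'.monomials = s.monomials ∪ {{i, j}, {i, i, j}}

/-- One iteration of Step 3: add the revlex smallest missing triangle and the revlex smallest
available monomial of degree 3. -/
def FStep (s s' : State) : Prop :=
  ∃ (G : Finset ℕ) (μ : Multiset ℕ), IsLeastMissingFace s.complex 3 G ∧
    IsLeastAvailable s.monomials 3 μ ∧
    s'.complex = insert G s.complex ∧ s'.monomials = insert μ s.monomials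

/-- `iterate R n s s'`: some chain of `n` steps of `R` leads from `s` to `s'`. -/
def iterate (R : State → State → Prop) : ℕ → State → State → Prop
  | 0, s, s' => s = s'
  | n + 1, s, s' => ∃ u, iterate R n s u ∧ R u s'

/-- The algorithm, run with `η τ` ears of each type `τ`, completes all its steps and outputs `s`:
`s.complex` is the compressed complex and `s.monomials` the associated set of monomials. -/
def IsOutput (η : EarType → ℕ) (s : State) : Prop :=
  ∃ u, iterate EStep (η .E) (initialState (η .A) (η .B)) u ∧ iterate FStep (η .F) u s

end Algorithm

end PSEar

/-! Write a, b, e, f for the numbers of ears of types A, B, E, F. Attaching an ear along its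
boundary adds exactly the interior faces of the ear, so the complex has 4+a+b vertices, 6+3a+4b+e
edges and 4+3a+4b+2e+f triangles, and its h-vector is (1, 1+a+b, 1+a+2b+e, 1+a+b+e+f). The monomials
added by the algorithm contribute these same amounts degree by degree. All equalities thus hold as
soon as the algorithm does not get stuck, and this is the real content.

From the given complex come three inequalities (`IsTetrahedralDecomposition.bounds`). One says that
there are at most C(4+a+b, 2) edges. The other two bound the triangles by a Kruskal-Katona argument
relative to the ears (`SurplusBound.insert`). Insert the vertices in the order in which cone ears
introduce them; each has a guaranteed number of earlier neighbors, 3 for type A and c for type B,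
where c is 3 or 4. All other edges are surplus. A surplus of m edges creates at most c*m + `kkTri m`
triangles beyond the guaranteed ones; for c = 4 the surplus is e, and for c = 3 it is b+e.

On the side of the algorithm, the earlier neighbors of v_j always form an initial segment v_1, ...,
v_{D j}, and Step 2 saturates the vertices one after another (`Profile`). These segments are
cliques, so the graph has the sum of C(D j, 2) triangles, and this sum attains one of the two bounds
(`Profile.le_sum_choose`). Hence a missing triangle exists as long as Step 3 needs one
(`IsCompressedComplex.exists_missing_triangle`). The monomials follow the same profile: x_i x_j with
4 ≤ i < j is present exactly when v_i v_j is an edge, and all squares x_i^2 are present. The number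
of cubics with all quadratic divisors present is then the sum of C(D j - 1, 2) over j ≥ 4. By
`Profile.sum_choose_eq` it differs from the number of graph triangles by 3+2a+3b+e, exactly as the
number of cubics in the multicomplex differs from the number of triangular faces. So triangles and
cubics run out at the same moment. -/

namespace PSEar

/-! ### Arithmetic of the Kruskal-Katona function for triangles -/

section KruskalKatona

/-- The maximal number of triangles in a graph with `m` edges: `C(k,3) + C(r,2)` if
`m = C(k,2) + r` with `r ≤ k`. -/
def kkTri (m : ℕ) : ℕ :=
  (Nat.findGreatest (fun k => k.choose 2 ≤ m) (m + 1)).choose 3 +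
    (m - (Nat.findGreatest (fun k => k.choose 2 ≤ m) (m + 1)).choose 2).choose 2

theorem choose_two_succ (k : ℕ) : (k + 1).choose 2 = k.choose 2 + k := by
  rw [Nat.choose_succ_succ' k 1, Nat.choose_one_right, add_comm]

theorem choose_three_succ (k : ℕ) : (k + 1).choose 3 = k.choose 3 + k.choose 2 := by
  rw [Nat.choose_succ_succ' k 2, add_comm]

theorem choose_two_add (m n : ℕ) : (m + n).choose 2 = m.choose 2 + m * n + n.choose 2 := by
  induction n with
  | zero => simp
  | succ n ih => rw [← add_assoc, choose_two_succ, ih, choose_two_succ]; ring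

/-- This guarantees that the search range `m + 1` in `kkTri` contains the wanted `k`. -/
theorem le_choose_two_succ (k : ℕ) : k ≤ k.choose 2 + 1 := by
  induction k with
  | zero => simp
  | succ k ih => rw [choose_two_succ]; rcases k with _ | k <;> omega

theorem kkTri_of_lt {k r : ℕ} (h : r < k) :
    kkTri (k.choose 2 + r) = k.choose 3 + r.choose 2 := by
  have hk : Nat.findGreatest (fun l => l.choose 2 ≤ k.choose 2 + r) (k.choose 2 + r + 1) = k := by
    rw [Nat.findGreatest_eq_iff]
    refine ⟨by have := le_choose_two_succ k; omega, fun _ => by omega, fun l hl _ hle => ?_⟩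
    have h1 := Nat.choose_le_choose 2 (Nat.succ_le_of_lt hl)
    rw [Nat.succ_eq_add_one, choose_two_succ] at h1
    omega
  unfold kkTri
  rw [hk]
  simp

/-- At r = k the representations C(k,2)+k and C(k+1,2)+0 of the same number give the same value by
Pascal's rule. -/
theorem kkTri_of_le {k r : ℕ} (h : r ≤ k) :
    kkTri (k.choose 2 + r) = k.choose 3 + r.choose 2 := by
  rcases h.lt_or_eq with h | rfl
  · exact kkTri_of_lt h
  · have := kkTri_of_lt (Nat.succ_pos r)
    rw [Nat.succ_eq_add_one, choose_two_succ, choose_three_succ] at this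
    simpa using this

theorem exists_eq_choose_two_add (m : ℕ) : ∃ k r, r < k ∧ m = k.choose 2 + r := by
  induction m with
  | zero => exact ⟨1, 0, by simp, by simp⟩
  | succ m ih =>
    obtain ⟨k, r, h, rfl⟩ := ih
    rcases (Nat.succ_le_of_lt h).lt_or_eq with h' | h'
    · exact ⟨k, r + 1, h', by ring⟩
    · exact ⟨k + 1, 0, by omega, by rw [choose_two_succ]; omega⟩

theorem kkTri_mono : Monotone kkTri := by
  refine monotone_nat_of_le_succ fun m => ?_
  obtain ⟨k, r, h, rfl⟩ := exists_eq_choose_two_add m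
  rw [kkTri_of_lt h, add_assoc, kkTri_of_le (Nat.succ_le_of_lt h), choose_two_succ]
  omega

/-- The recursive inequality behind the Kruskal-Katona theorem for triangles. -/
theorem kkTri_add_le (x ε : ℕ) : kkTri x + min (ε.choose 2) x ≤ kkTri (x + ε) := by
  obtain ⟨k, r, h, rfl⟩ := exists_eq_choose_two_add x
  -- For ε ≤ k the term C(ε,2) of the minimum suffices. For ε > k monotonicity reduces to ε = k+1,
  -- where x + ε = C(k+1,2) + (r+1) and the increase of `kkTri` is exactly x.
  rcases le_or_gt ε k with hk | hk
  · refine le_trans (Nat.add_le_add_left (min_le_left _ _) _) ?_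
    rw [kkTri_of_lt h, add_assoc (k.choose 2)]
    rcases le_or_gt (r + ε) k with h1 | h1
    · rw [kkTri_of_le h1, choose_two_add]
      nlinarith
    · obtain ⟨s, hs⟩ : ∃ s, r + ε = k + s := ⟨r + ε - k, by omega⟩
      rw [hs, ← add_assoc, ← choose_two_succ, kkTri_of_le (by omega),
        choose_three_succ]
      -- Since r + ε = k + s with s the smallest and k the largest of the four, convexity of C(·,2)
      -- decides; in these coordinates the two sides differ by u*w.
      obtain ⟨u, rfl⟩ : ∃ u, r = s + u := ⟨r - s, by omega⟩
      obtain ⟨w, rfl⟩ : ∃ w, ε = s + w := ⟨ε - s, by omega⟩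
      obtain rfl : k = s + u + w := by omega
      simp only [choose_two_add]
      nlinarith [Nat.zero_le (u * w)]
  · refine le_trans (Nat.add_le_add_left (min_le_right _ _) _) ?_
    refine le_trans ?_ (kkTri_mono (Nat.add_le_add_left (Nat.succ_le_of_lt hk) _))
    have : k.choose 2 + r + k.succ = (k + 1).choose 2 + (r + 1) := by
      rw [choose_two_succ]; omega
    rw [kkTri_of_lt h, this, kkTri_of_le (by omega), choose_two_succ, choose_three_succ]
    omega

end KruskalKatona

/-! ### Triangles in a graph built vertex by vertex -/

section Graphs

variable {V : Type*} [DecidableEq V] (G : Finset (Finset V))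

/-- The number of edges in `G` between vertices of `W`. -/
def edgeNum (W : Finset V) : ℕ :=
  ((W.powersetCard 2).filter (· ∈ G)).card

/-- The triangles of the graph `G` with vertices in `U`. -/
def triangles (U : Finset V) : Finset (Finset V) :=
  (U.powersetCard 3).filter fun t => ∀ s ∈ t.powersetCard 2, s ∈ G

/-- The neighbors of `v` in `U`. -/
def nbrs (v : V) (U : Finset V) : Finset V :=
  U.filter fun u => {v, u} ∈ G

variable {G}

theorem edgeNum_insert {v : V} {U : Finset V} (hv : v ∉ U) :
    edgeNum G (insert v U) = edgeNum G U + (nbrs G v U).card := by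
  unfold edgeNum nbrs
  rw [Finset.powersetCard_succ_insert hv, Finset.filter_union, Finset.card_union_of_disjoint]
  · congr 1
    rw [Finset.powersetCard_one]
    refine (Finset.card_bij (fun u _ => {v, u}) ?_ ?_ ?_).symm
    · intro u hu
      simp only [Finset.mem_filter] at hu
      simp only [Finset.mem_filter, Finset.mem_image, Finset.mem_map,
        Function.Embedding.coeFn_mk]
      exact ⟨⟨{u}, ⟨u, hu.1, rfl⟩, rfl⟩, hu.2⟩
    · intro u hu u' hu' h
      simp only [Finset.mem_filter] at hu hu'
      have : u ∈ ({v, u'} : Finset V) := by rw [← h]; simp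
      simp only [Finset.mem_insert, Finset.mem_singleton] at this
      rcases this with rfl | h
      · exact absurd hu.1 hv
      · exact h
    · intro p hp
      simp only [Finset.mem_filter, Finset.mem_image, Finset.mem_map,
        Function.Embedding.coeFn_mk] at hp
      obtain ⟨⟨_, ⟨u, hu, rfl⟩, rfl⟩, h⟩ := hp
      exact ⟨u, by simpa using ⟨hu, h⟩, rfl⟩
  · rw [Finset.disjoint_left]
    intro p hp hp'
    simp only [Finset.mem_filter, Finset.mem_powersetCard, Finset.mem_image] at hp hp'
    obtain ⟨⟨q, -, rfl⟩, -⟩ := hp'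
    exact hv (hp.1.1 (Finset.mem_insert_self _ _))

/-- A triangle through v consists of v and an edge between two neighbors of v. -/
theorem card_triangles_insert_le {v : V} {U : Finset V} (hv : v ∉ U) :
    (triangles G (insert v U)).card ≤ (triangles G U).card + edgeNum G (nbrs G v U) := by
  unfold triangles edgeNum
  rw [Finset.powersetCard_succ_insert hv, Finset.filter_union]
  refine (Finset.card_union_le _ _).trans (Nat.add_le_add_left ?_ _)
  refine le_trans (Finset.card_le_card ?_) (Finset.card_image_le (f := insert v))
  intro t ht
  simp only [Finset.mem_filter, Finset.mem_image, Finset.mem_powersetCard] at ht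
  obtain ⟨⟨p, ⟨hpU, hp2⟩, rfl⟩, h⟩ := ht
  have hvp : v ∉ p := fun h => hv (hpU h)
  simp only [Finset.mem_image, Finset.mem_filter, Finset.mem_powersetCard]
  refine ⟨p, ⟨⟨fun u hu => ?_, hp2⟩, h p ⟨Finset.subset_insert _ _, hp2⟩⟩, rfl⟩
  simp only [nbrs, Finset.mem_filter]
  refine ⟨hpU hu, h _ ⟨?_, Finset.card_pair ?_⟩⟩
  · exact Finset.insert_subset_insert _ (by simpa using hu)
  · rintro rfl; exact hvp hu

theorem edgeNum_le_choose (W : Finset V) : edgeNum G W ≤ W.card.choose 2 :=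
  (Finset.card_filter_le _ _).trans (Finset.card_powersetCard 2 W).le

variable (G)

/-- The graph induced on `U` has `m + e` edges, of which `e` are regarded as surplus; a set of
vertices spans at most `e` edges more than it would if its members had at most `c` earlier
neighbors each; and the number of triangles obeys the resulting Kruskal-Katona bound. -/
structure SurplusBound (c : ℕ) (U : Finset V) (m T e : ℕ) : Prop where
  edges : edgeNum G U = m + e
  tri : (triangles G U).card ≤ T + c * e + kkTri e
  sub : ∀ W, W ⊆ U → edgeNum G W ≤ (∑ p ∈ Finset.range W.card, min p c) + e

variable {G}

theorem SurplusBound.empty (c : ℕ) : SurplusBound G c ∅ 0 0 0 where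
  edges := by simp [edgeNum]
  tri := by
    rw [triangles, Finset.powersetCard_eq_empty.2 (by simp)]
    simp
  sub W hW := by
    obtain rfl := Finset.subset_empty.1 hW
    simp [edgeNum]

/-- The first w terms are bounded by p and the remaining ε by c. It is applied to the w + ε
neighbors of a new vertex. -/
theorem sum_min_add_le (w c ε : ℕ) :
    ∑ p ∈ Finset.range (w + ε), min p c ≤ w.choose 2 + c * ε := by
  rw [Finset.sum_range_add]
  refine Nat.add_le_add ?_ ?_
  · rw [Nat.choose_two_right, ← Finset.sum_range_id]
    exact Finset.sum_le_sum fun p _ => min_le_left _ _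
  · calc _ ≤ ∑ _p ∈ Finset.range ε, c := Finset.sum_le_sum fun p _ => min_le_right _ _
      _ = c * ε := by simp [mul_comm]

/-- Let v have w + ε neighbors in U, so that ε edges are new surplus. The edges between these
neighbors number at most C(w+ε,2) = C(w,2) + wε + C(ε,2) trivially, and at most C(w,2) + cε + e by
`sub`. The triangles at v beyond C(w,2) + cε are therefore at most min(C(ε,2), e), which
`kkTri_add_le` absorbs. -/
theorem SurplusBound.insert {c : ℕ} {U : Finset V} {m T e : ℕ} (H : SurplusBound G c U m T e)
    {v : V} (hv : v ∉ U) {w : ℕ} (hw : w ≤ c) (hN : w ≤ (nbrs G v U).card) :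
    ∃ e', SurplusBound G c (insert v U) (m + w) (T + w.choose 2) e' := by
  obtain ⟨ε, hε⟩ := Nat.exists_eq_add_of_le hN
  refine ⟨e + ε, ?_, ?_, ?_⟩
  · rw [edgeNum_insert hv, H.edges, hε]; ring
  · refine (card_triangles_insert_le hv).trans ?_
    have h1 : edgeNum G (nbrs G v U) ≤ w.choose 2 + c * ε + min (ε.choose 2) e := by
      rw [← min_add_add_left]
      refine le_min ?_ ?_
      · refine (edgeNum_le_choose _).trans ?_
        rw [hε, choose_two_add]
        have := Nat.mul_le_mul_right ε hw
        omega
      · refine (H.sub (nbrs G v U) (Finset.filter_subset _ _)).trans ?_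
        rw [hε]
        exact Nat.add_le_add_right (sum_min_add_le w c ε) e
    have h2 := kkTri_add_le e ε
    have h3 := H.tri
    rw [mul_add]
    omega
  · intro W hW
    by_cases hvW : v ∈ W
    · have h1 : W.erase v ⊆ U := fun u hu => by
        have := hW (Finset.mem_of_mem_erase hu)
        exact (Finset.mem_insert.1 this).resolve_left (Finset.ne_of_mem_erase hu)
      have h2 : v ∉ W.erase v := Finset.notMem_erase v W
      have h3 := H.sub _ h1
      -- With q = |W| - 1, the vertex v contributes at most min(q, w+ε) ≤ min(q, c) + ε edges,
      -- because w ≤ c.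
      have h4 : (nbrs G v (W.erase v)).card ≤ (W.erase v).card := Finset.card_filter_le _ _
      have h5 : (nbrs G v (W.erase v)).card ≤ w + ε := by
        rw [← hε]
        exact Finset.card_le_card (Finset.filter_subset_filter _ h1)
      rw [← Finset.insert_erase hvW, edgeNum_insert h2, Finset.card_insert_of_notMem h2,
        Finset.sum_range_succ]
      omega
    · have h1 : W ⊆ U := fun u hu => by
        refine (Finset.mem_insert.1 (hW hu)).resolve_left ?_
        rintro rfl; exact hvW hu
      have := H.sub W h1
      omega

end Graphs

/-! ### Joins, face numbers and the four types of ears -/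

section Balls

variable {V : Type*} [DecidableEq V]

/-- The vertices of a complex. -/
def verts (Γ : Finset (Finset V)) : Finset V :=
  Γ.biUnion id

theorem mem_verts {Γ : Finset (Finset V)} {v : V} : v ∈ verts Γ ↔ ∃ F ∈ Γ, v ∈ F := by
  simp [verts]

theorem subset_verts {Γ : Finset (Finset V)} {F : Finset V} (h : F ∈ Γ) : F ⊆ verts Γ :=
  fun _ hv => mem_verts.2 ⟨F, h, hv⟩

theorem IsComplex.mem_verts {Γ : Finset (Finset V)} (h : IsComplex Γ) {v : V} :
    v ∈ verts Γ ↔ {v} ∈ Γ := by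
  rw [PSEar.mem_verts]
  refine ⟨fun ⟨F, hF, hv⟩ => ?_, fun hv => ⟨_, hv, by simp⟩⟩
  exact h (show ({v} : Finset V) ≤ F by simpa using hv) hF

theorem verts_union (Γ Λ : Finset (Finset V)) : verts (Γ ∪ Λ) = verts Γ ∪ verts Λ := by
  ext; simp [mem_verts, or_and_right, exists_or]

theorem verts_mono {Γ Λ : Finset (Finset V)} (h : Γ ⊆ Λ) : verts Γ ⊆ verts Λ :=
  Finset.biUnion_subset_biUnion_of_subset_left _ h

theorem IsComplex.union {Γ Λ : Finset (Finset V)} (h : IsComplex Γ) (h' : IsComplex Λ) :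
    IsComplex (Γ ∪ Λ) := by
  unfold IsComplex at *
  rw [Finset.coe_union]
  exact IsLowerSet.union h h'

theorem mem_join {Γ Λ : Finset (Finset V)} {F : Finset V} :
    F ∈ join Γ Λ ↔ ∃ A ∈ Γ, ∃ B ∈ Λ, A ∪ B = F := by
  simp [join, Finset.mem_image₂]

theorem IsComplex.join {Γ Λ : Finset (Finset V)} (h : IsComplex Γ) (h' : IsComplex Λ) :
    IsComplex (join Γ Λ) := by
  intro F G hG hF
  rw [Finset.mem_coe, mem_join] at hF ⊢
  obtain ⟨A, hA, B, hB, rfl⟩ := hF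
  refine ⟨A ∩ G, h Finset.inter_subset_left hA, B ∩ G, h' Finset.inter_subset_left hB, ?_⟩
  rw [← Finset.union_inter_distrib_right]
  exact Finset.inter_eq_right.2 hG

theorem isComplex_powerset {V : Type*} (S : Finset V) : IsComplex S.powerset := by
  intro F G hG hF
  simp only [Finset.mem_coe, Finset.mem_powerset] at *
  exact hG.trans hF

theorem isComplex_ssubsets (S : Finset V) : IsComplex S.ssubsets := by
  intro F G hG hF
  simp only [Finset.mem_coe, Finset.mem_ssubsets] at *
  exact lt_of_le_of_lt hG hF

theorem isComplex_boundaryJoin (L : List (Finset V)) : IsComplex (boundaryJoin L) := by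
  induction L with
  | nil =>
    intro F G hG hF
    simp only [boundaryJoin, Finset.coe_singleton, Set.mem_singleton_iff] at *
    subst hF
    exact Finset.subset_empty.1 hG
  | cons S L ih => exact (isComplex_ssubsets S).join ih

theorem join_empty_left (Λ : Finset (Finset V)) : join {∅} Λ = Λ := by
  ext; simp [mem_join]

theorem join_empty_right (Λ : Finset (Finset V)) : join Λ {∅} = Λ := by
  ext; simp [mem_join]

theorem verts_join {Γ Λ : Finset (Finset V)} (h : Γ.Nonempty) (h' : Λ.Nonempty) :
    verts (join Γ Λ) = verts Γ ∪ verts Λ := by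
  ext v
  simp only [Finset.mem_union, mem_verts, mem_join]
  constructor
  · rintro ⟨_, ⟨A, hA, B, hB, rfl⟩, hv⟩
    rcases Finset.mem_union.1 hv with hv | hv
    exacts [.inl ⟨A, hA, hv⟩, .inr ⟨B, hB, hv⟩]
  · rintro (⟨A, hA, hv⟩ | ⟨B, hB, hv⟩)
    · obtain ⟨B, hB⟩ := h'
      exact ⟨_, ⟨A, hA, B, hB, rfl⟩, by simp [hv]⟩
    · obtain ⟨A, hA⟩ := h
      exact ⟨_, ⟨A, hA, B, hB, rfl⟩, by simp [hv]⟩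

theorem verts_powerset (S : Finset V) : verts S.powerset = S := by
  ext v
  simp only [mem_verts, Finset.mem_powerset]
  exact ⟨fun ⟨F, hF, hv⟩ => hF hv, fun hv => ⟨S, le_rfl, hv⟩⟩

theorem verts_ssubsets {S : Finset V} (h : 2 ≤ S.card) : verts S.ssubsets = S := by
  ext v
  simp only [mem_verts, Finset.mem_ssubsets]
  refine ⟨fun ⟨F, hF, hv⟩ => hF.1 hv, fun hv => ⟨{v}, ?_, by simp⟩⟩
  refine Finset.ssubset_iff_subset_ne.2 ⟨by simpa using hv, ?_⟩
  rintro rfl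
  simp at h

theorem verts_ssubsets_subset (S : Finset V) : verts S.ssubsets ⊆ S := by
  intro v
  simp only [mem_verts, Finset.mem_ssubsets]
  exact fun ⟨F, hF, hv⟩ => hF.1 hv

theorem boundaryJoin_nonempty {L : List (Finset V)} (h : ∀ S ∈ L, 1 ≤ S.card) :
    (boundaryJoin L).Nonempty := by
  induction L with
  | nil => exact ⟨∅, by simp [boundaryJoin]⟩
  | cons S L ih =>
    refine Finset.Nonempty.image₂ ?_ (ih fun T hT => h T (by simp [hT]))
    exact ⟨∅, Finset.empty_mem_ssubsets (Finset.card_pos.1 (h S (by simp)))⟩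

theorem exists_mem_of_mem_verts_boundaryJoin {L : List (Finset V)} {v : V}
    (h : v ∈ verts (boundaryJoin L)) : ∃ S ∈ L, v ∈ S := by
  obtain ⟨F, hF, hv⟩ := mem_verts.1 h
  induction L generalizing F with
  | nil =>
    simp only [boundaryJoin, Finset.mem_singleton] at hF
    simp [hF] at hv
  | cons S L ih =>
    obtain ⟨A, hA, B, hB, rfl⟩ := mem_join.1 hF
    rcases Finset.mem_union.1 hv with hv | hv
    · exact ⟨S, by simp, (Finset.mem_ssubsets.1 hA).1 hv⟩
    · obtain ⟨T, hT, hvT⟩ := ih (mem_verts.2 ⟨B, hB, hv⟩) B hB hv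
      exact ⟨T, by simp [hT], hvT⟩

theorem disjoint_verts_boundaryJoin {S : Finset V} {L : List (Finset V)}
    (h : (S :: L).Pairwise Disjoint) : Disjoint S (verts (boundaryJoin L)) := by
  rw [Finset.disjoint_left]
  intro v hv hv'
  obtain ⟨T, hT, hvT⟩ := exists_mem_of_mem_verts_boundaryJoin hv'
  exact Finset.disjoint_left.1 ((List.pairwise_cons.1 h).1 T hT) hv hvT

/-! ### Face numbers -/

/-- The convolution of two sequences. -/
def conv (f g : ℕ → ℕ) (i : ℕ) : ℕ :=
  ∑ j ∈ Finset.range (i + 1), f j * g (i - j)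

/-- Disjoint supports let A ∪ B determine A and B, and make cardinalities add. -/
theorem fNum_join {Γ Λ : Finset (Finset V)} {S T : Finset V} (hΓ : verts Γ ⊆ S)
    (hΛ : verts Λ ⊆ T) (hST : Disjoint S T) (i : ℕ) :
    fNum (join Γ Λ) i = conv (fNum Γ) (fNum Λ) i := by
  have hinj : ∀ A ∈ Γ, ∀ B ∈ Λ, (A ∪ B) ∩ S = A ∧ (A ∪ B) ∩ T = B := by
    intro A hA B hB
    have h1 : A ⊆ S := (subset_verts hA).trans hΓ
    have h2 : B ⊆ T := (subset_verts hB).trans hΛ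
    have h3 : A ∩ T = ∅ := Finset.disjoint_iff_inter_eq_empty.1 (hST.mono_left h1)
    have h4 : B ∩ S = ∅ := Finset.disjoint_iff_inter_eq_empty.1 (hST.symm.mono_left h2)
    rw [Finset.union_inter_distrib_right, Finset.union_inter_distrib_right, h3, h4,
      Finset.inter_eq_left.2 h1, Finset.inter_eq_left.2 h2]
    simp
  have hcard : ∀ A ∈ Γ, ∀ B ∈ Λ, (A ∪ B).card = A.card + B.card := fun A hA B hB =>
    Finset.card_union_of_disjoint
      (hST.mono ((subset_verts hA).trans hΓ) ((subset_verts hB).trans hΛ))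
  have key : (join Γ Λ).filter (fun F => F.card = i) =
      (Finset.range (i + 1)).biUnion fun j =>
        join (Γ.filter fun F => F.card = j) (Λ.filter fun F => F.card = i - j) := by
    ext F
    simp only [Finset.mem_filter, Finset.mem_biUnion, mem_join, Finset.mem_range]
    constructor
    · rintro ⟨⟨A, hA, B, hB, rfl⟩, h⟩
      rw [hcard A hA B hB] at h
      exact ⟨A.card, by omega, A, ⟨hA, rfl⟩, B, ⟨hB, by omega⟩, rfl⟩
    · rintro ⟨j, hj, A, ⟨hA, hAj⟩, B, ⟨hB, hBj⟩, rfl⟩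
      exact ⟨⟨A, hA, B, hB, rfl⟩, by rw [hcard A hA B hB]; omega⟩
  unfold fNum conv
  rw [key, Finset.card_biUnion]
  · refine Finset.sum_congr rfl fun j _ => ?_
    unfold join
    rw [Finset.card_image₂_iff.2]
    rintro ⟨A, B⟩ h ⟨A', B'⟩ h' he
    simp only [Set.mem_prod, Finset.mem_coe, Finset.mem_filter] at h h'
    have h1 := hinj A h.1.1 B h.2.1
    have h2 := hinj A' h'.1.1 B' h'.2.1
    simp only at he
    rw [he] at h1
    exact Prod.ext (h1.1.symm.trans h2.1) (h1.2.symm.trans h2.2)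
  · intro j _ j' _ hne
    rw [Function.onFun, Finset.disjoint_left]
    intro F hF hF'
    obtain ⟨A, hA, B, hB, rfl⟩ := mem_join.1 hF
    obtain ⟨A', hA', B', hB', he⟩ := mem_join.1 hF'
    rw [Finset.mem_filter] at hA hB hA' hB'
    have h1 := hinj A hA.1 B hB.1
    have h2 := hinj A' hA'.1 B' hB'.1
    rw [he] at h2
    have := h1.1.symm.trans h2.1
    subst this
    exact hne (hA.2.symm.trans hA'.2)

theorem fNum_powerset {V : Type*} (S : Finset V) (i : ℕ) : fNum S.powerset i = S.card.choose i := by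
  unfold fNum
  rw [← Finset.card_powersetCard, Finset.powersetCard_eq_filter]

/-- The face numbers of the boundary of a simplex with `m` vertices. -/
def bdryF (m i : ℕ) : ℕ :=
  if i < m then m.choose i else 0

theorem fNum_ssubsets (S : Finset V) (i : ℕ) : fNum S.ssubsets i = bdryF S.card i := by
  unfold fNum bdryF
  split_ifs with h
  · rw [← Finset.card_powersetCard]
    congr 1
    ext F
    simp only [Finset.mem_filter, Finset.mem_ssubsets, Finset.mem_powersetCard]
    refine ⟨fun ⟨h1, h2⟩ => ⟨h1.1, h2⟩, fun ⟨h1, h2⟩ => ⟨?_, h2⟩⟩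
    refine Finset.ssubset_iff_subset_ne.2 ⟨h1, ?_⟩
    rintro rfl; omega
  · rw [Finset.card_eq_zero, Finset.filter_eq_empty_iff]
    intro F hF hi
    have := Finset.card_lt_card (Finset.mem_ssubsets.1 hF)
    omega

/-- The face numbers of `∂σ^{d₁} * ... * ∂σ^{dₖ}`. -/
def sphereF : List ℕ → ℕ → ℕ
  | [] => fun i => if i = 0 then 1 else 0
  | m :: l => conv (bdryF (m + 1)) (sphereF l)

theorem fNum_boundaryJoin {L : List (Finset V)} {dims : List ℕ}
    (hL : L.map Finset.card = dims.map (· + 1)) (h : L.Pairwise Disjoint) :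
    fNum (boundaryJoin L) = sphereF dims := by
  induction L generalizing dims with
  | nil =>
    rcases dims with _ | ⟨m, dims⟩
    · funext i
      simp only [fNum, boundaryJoin, sphereF, Finset.filter_singleton, Finset.card_empty]
      rcases i with _ | i <;> simp
    · simp at hL
  | cons S L ih =>
    rcases dims with _ | ⟨m, dims⟩
    · simp at hL
    · simp only [List.map_cons, List.cons.injEq] at hL
      funext i
      rw [boundaryJoin, fNum_join (verts_ssubsets_subset S) le_rfl (disjoint_verts_boundaryJoin h),
        ih hL.2 (List.pairwise_cons.1 h).2, sphereF]
      congr 1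
      funext j
      rw [fNum_ssubsets, hL.1]

theorem IsBallOfType.fNum {k : ℕ} {dims : List ℕ} {B bd : Finset (Finset V)}
    (h : IsBallOfType k dims B bd) :
    fNum B = conv (Nat.choose (k + 1)) (sphereF dims) ∧
      fNum bd = conv (bdryF (k + 1)) (sphereF dims) := by
  obtain ⟨S, L, hS, hL, hd, rfl, rfl⟩ := h
  constructor
  · funext i
    rw [fNum_join (verts_powerset S).le le_rfl (disjoint_verts_boundaryJoin hd),
      fNum_boundaryJoin hL (List.pairwise_cons.1 hd).2]
    congr 1
    funext j
    rw [fNum_powerset, hS]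
  · funext i
    rw [fNum_join (verts_ssubsets_subset S) le_rfl (disjoint_verts_boundaryJoin hd),
      fNum_boundaryJoin hL (List.pairwise_cons.1 hd).2]
    congr 1
    funext j
    rw [fNum_ssubsets, hS]

theorem fNum_union_add_inter (Γ Λ : Finset (Finset V)) (i : ℕ) :
    fNum (Γ ∪ Λ) i + fNum (Γ ∩ Λ) i = fNum Γ i + fNum Λ i := by
  unfold fNum
  rw [Finset.filter_union, Finset.filter_inter_distrib, Finset.card_union_add_card_inter]

/-! ### Ranks -/

theorem card_le_rank {V : Type*} {Γ : Finset (Finset V)} {F : Finset V} (h : F ∈ Γ) : F.card ≤ rank Γ :=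
  Finset.le_sup (f := Finset.card) h

theorem exists_card_eq_rank {V : Type*} {Γ : Finset (Finset V)} (h : Γ.Nonempty) :
    ∃ F ∈ Γ, F.card = rank Γ := by
  obtain ⟨F, hF, he⟩ := Finset.exists_mem_eq_sup Γ h Finset.card
  exact ⟨F, hF, he.symm⟩

theorem rank_eq_of {V : Type*} {Γ : Finset (Finset V)} {m : ℕ} (h : ∀ F ∈ Γ, F.card ≤ m)
    (h' : ∃ F ∈ Γ, F.card = m) : rank Γ = m := by
  obtain ⟨F, hF, rfl⟩ := h'
  exact le_antisymm (Finset.sup_le h) (card_le_rank hF)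

theorem rank_join {Γ Λ : Finset (Finset V)} (hΓ : Γ.Nonempty) (hΛ : Λ.Nonempty)
    (h : Disjoint (verts Γ) (verts Λ)) : rank (join Γ Λ) = rank Γ + rank Λ := by
  refine rank_eq_of ?_ ?_
  · intro F hF
    obtain ⟨A, hA, B, hB, rfl⟩ := mem_join.1 hF
    exact (Finset.card_union_le _ _).trans (Nat.add_le_add (card_le_rank hA) (card_le_rank hB))
  · obtain ⟨A, hA, hA'⟩ := exists_card_eq_rank hΓ
    obtain ⟨B, hB, hB'⟩ := exists_card_eq_rank hΛ
    refine ⟨A ∪ B, mem_join.2 ⟨A, hA, B, hB, rfl⟩, ?_⟩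
    rw [Finset.card_union_of_disjoint (h.mono (subset_verts hA) (subset_verts hB)), hA', hB']

theorem rank_powerset {V : Type*} (S : Finset V) : rank S.powerset = S.card :=
  rank_eq_of (fun _ h => Finset.card_le_card (Finset.mem_powerset.1 h))
    ⟨S, Finset.mem_powerset_self S, rfl⟩

theorem rank_ssubsets {S : Finset V} (h : 1 ≤ S.card) : rank S.ssubsets = S.card - 1 := by
  obtain ⟨v, hv⟩ := Finset.card_pos.1 h
  refine rank_eq_of (fun F hF => ?_) ⟨S.erase v, ?_, Finset.card_erase_of_mem hv⟩
  · have := Finset.card_lt_card (Finset.mem_ssubsets.1 hF)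
    omega
  · exact Finset.mem_ssubsets.2 (Finset.erase_ssubset hv)

theorem rank_boundaryJoin {L : List (Finset V)} (h : ∀ S ∈ L, 1 ≤ S.card)
    (hd : L.Pairwise Disjoint) :
    rank (boundaryJoin L) = (L.map fun S => S.card - 1).sum := by
  induction L with
  | nil => simp [boundaryJoin, rank]
  | cons S L ih =>
    have hS : 1 ≤ S.card := h S (by simp)
    have hL : ∀ T ∈ L, 1 ≤ T.card := fun T hT => h T (by simp [hT])
    rw [boundaryJoin, rank_join ⟨∅, Finset.empty_mem_ssubsets (Finset.card_pos.1 hS)⟩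
      (boundaryJoin_nonempty hL), rank_ssubsets hS, ih hL (List.pairwise_cons.1 hd).2]
    · simp
    · exact (disjoint_verts_boundaryJoin hd).mono_left (verts_ssubsets_subset S)

/-! ### Classification of two-dimensional PS balls -/

/-- A factor with one vertex is ∂σ^0 = {∅}, the unit of the join. Dropping such factors is what
leaves only finitely many shapes of ears. -/
theorem boundaryJoin_filter {L : List (Finset V)} (h : ∀ S ∈ L, 1 ≤ S.card) :
    boundaryJoin (L.filter fun S => 2 ≤ S.card) = boundaryJoin L := by
  induction L with
  | nil => simp
  | cons S L ih =>
    have ih := ih fun T hT => h T (by simp [hT])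
    rw [List.filter_cons]
    split_ifs with hS
    · rw [boundaryJoin, boundaryJoin, ih]
    · have h1 : 1 ≤ S.card := h S (by simp)
      obtain ⟨v, rfl⟩ := Finset.card_eq_one.1 (show S.card = 1 by simp at hS; omega)
      rw [boundaryJoin, ih]
      have : ({v} : Finset V).ssubsets = {∅} := by
        ext F; simp
      rw [this, join_empty_left]

/-- The dimensions of the simplex and of the simplex boundaries whose join is an ear of a given
type. -/
def earDims : EarType → ℕ × List ℕ
  | .A => (0, [2])
  | .B => (0, [1, 1])
  | .E => (1, [1])
  | .F => (2, [])

/-- `B` is an ear of type `τ` with boundary `bd`. -/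
def IsEarWithBoundary (τ : EarType) (B bd : Finset (Finset V)) : Prop :=
  IsBallOfType (earDims τ).1 (earDims τ).2 B bd

theorem isEar_iff {τ : EarType} {B : Finset (Finset V)} :
    IsEar τ B ↔ ∃ bd, IsEarWithBoundary τ B bd := by
  cases τ <;> rfl

/-- Without the trivial factors, the simplex and every simplex boundary each contribute at least 1
to the rank 3. So at most two boundaries occur, and the possible dimensions are those of the four
types. -/
theorem exists_isEarWithBoundary {B bd : Finset (Finset V)} (h : IsPSBall 3 B bd) :
    ∃ τ, IsEarWithBoundary τ B bd := by
  obtain ⟨hr, k, dims, S, L, hS, hL, hd, rfl, rfl⟩ := h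
  have hL1 : ∀ T ∈ L, 1 ≤ T.card := by
    intro T hT
    have : T.card ∈ L.map Finset.card := List.mem_map_of_mem hT
    rw [hL] at this
    obtain ⟨m, -, hm⟩ := List.mem_map.1 this
    omega
  rw [← boundaryJoin_filter hL1] at hr ⊢
  have hd' : (S :: L.filter fun S => 2 ≤ S.card).Pairwise Disjoint :=
    hd.sublist (List.filter_sublist.cons_cons S)
  have hL2 : ∀ T ∈ L.filter fun S => 2 ≤ S.card, 2 ≤ T.card := by
    intro T hT
    simpa using (List.mem_filter.1 hT).2
  generalize (L.filter fun S => 2 ≤ S.card) = K at hr hd' hL2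
  have hK1 : ∀ T ∈ K, 1 ≤ T.card := fun T hT => one_le_two.trans (hL2 T hT)
  rw [rank_join ⟨_, Finset.empty_mem_powerset S⟩ (boundaryJoin_nonempty hK1)
    (by rw [verts_powerset]; exact disjoint_verts_boundaryJoin hd'), rank_powerset,
    rank_boundaryJoin hK1 (List.pairwise_cons.1 hd').2, hS] at hr
  rcases K with _ | ⟨X, _ | ⟨Y, _ | ⟨Z, K⟩⟩⟩
  · exact ⟨.F, S, [], by simp at hr; simp [earDims]; omega, by simp [earDims], hd', rfl, rfl⟩
  · have hX := hL2 X (by simp)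
    simp only [List.map_cons, List.map_nil, List.sum_cons, List.sum_nil] at hr
    obtain h | h : k = 0 ∨ k = 1 := by omega
    · exact ⟨.A, S, [X], by simp [earDims]; omega, by simp [earDims]; omega, hd', rfl, rfl⟩
    · exact ⟨.E, S, [X], by simp [earDims]; omega, by simp [earDims]; omega, hd', rfl, rfl⟩
  · have hX := hL2 X (by simp)
    have hY := hL2 Y (by simp)
    simp only [List.map_cons, List.map_nil, List.sum_cons, List.sum_nil] at hr
    exact ⟨.B, S, [X, Y], by simp [earDims]; omega, by simp [earDims]; omega, hd', rfl, rfl⟩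
  · have hX := hL2 X (by simp)
    have hY := hL2 Y (by simp)
    have hZ := hL2 Z (by simp)
    simp only [List.map_cons, List.sum_cons] at hr
    omega

/-- The number of faces with `i ≤ 3` vertices in the interior of an ear. -/
def earInterior : EarType → ℕ → ℕ
  | .A => fun i => [0, 1, 3, 3].getD i 0
  | .B => fun i => [0, 1, 4, 4].getD i 0
  | .E => fun i => [0, 0, 1, 2].getD i 0
  | .F => fun i => [0, 0, 0, 1].getD i 0

theorem IsEarWithBoundary.fNum_eq {τ : EarType} {B bd : Finset (Finset V)}
    (h : IsEarWithBoundary τ B bd) {i : ℕ} (hi : i ≤ 3) :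
    fNum B i = fNum bd i + earInterior τ i := by
  rw [(IsBallOfType.fNum h).1, (IsBallOfType.fNum h).2]
  cases τ <;> interval_cases i <;> decide

theorem IsEarWithBoundary.fNum_three {τ : EarType} {B bd : Finset (Finset V)}
    (h : IsEarWithBoundary τ B bd) : fNum B 3 = earInterior τ 3 := by
  rw [(IsBallOfType.fNum h).1]
  cases τ <;> decide

/-- The numbers of triangles 3, 4, 2, 1 of the types A, B, E, F are distinct, so an ear has only one
type. -/
theorem IsEarWithBoundary.isEar_iff {τ σ : EarType} {B bd : Finset (Finset V)}
    (h : IsEarWithBoundary τ B bd) : IsEar σ B ↔ σ = τ := by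
  refine ⟨fun h' => ?_, ?_⟩
  · obtain ⟨bd', h'⟩ := PSEar.isEar_iff.1 h'
    have := h'.fNum_three.symm.trans h.fNum_three
    cases τ <;> cases σ <;> simp [earInterior] at this ⊢
  · rintro rfl
    exact PSEar.isEar_iff.2 ⟨bd, h⟩

theorem IsEarWithBoundary.isComplex {τ : EarType} {B bd : Finset (Finset V)}
    (h : IsEarWithBoundary τ B bd) : IsComplex B := by
  obtain ⟨S, L, -, -, -, rfl, -⟩ := h
  exact (isComplex_powerset S).join (isComplex_boundaryJoin L)

end Balls

/-! ### Numerical consequences of an ear-decomposition -/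

section EarDecompositions

variable {V : Type*} [DecidableEq V]

/-- The union of the first ears `P 0, ..., P j`. -/
def partialUnion (P : ℕ → Finset (Finset V)) (j : ℕ) : Finset (Finset V) :=
  (Finset.range (j + 1)).biUnion P

theorem partialUnion_zero (P : ℕ → Finset (Finset V)) : partialUnion P 0 = P 0 := by
  simp [partialUnion]

theorem partialUnion_succ (P : ℕ → Finset (Finset V)) (j : ℕ) :
    partialUnion P (j + 1) = partialUnion P j ∪ P (j + 1) := by
  unfold partialUnion
  rw [Finset.range_add_one (n := j + 1), Finset.biUnion_insert, Finset.union_comm]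

theorem earCount_zero (P : ℕ → Finset (Finset V)) (τ : EarType) : earCount 0 P τ = 0 := by
  simp [earCount]

theorem earCount_succ {t : ℕ} {P : ℕ → Finset (Finset V)} {τ : EarType} {bd : Finset (Finset V)}
    (h : IsEarWithBoundary τ (P (t + 1)) bd) (σ : EarType) [Decidable (σ = τ)] :
    earCount (t + 1) P σ = earCount t P σ + if σ = τ then 1 else 0 := by
  classical
  unfold earCount
  rw [← Finset.insert_Icc_right_eq_Icc_add_one (by omega), Finset.filter_insert]
  simp only [h.isEar_iff]
  split_ifs
  · rw [Finset.card_insert_of_notMem (by simp)]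
  · rfl

/-- The part of a PS ear-decomposition relevant for counting: `P 0` is the boundary of the
tetrahedron `T`, and `P j` is an ear attached to `P 0 ∪ ... ∪ P (j - 1)` along its boundary. -/
structure IsTetrahedralDecomposition (t : ℕ) (P : ℕ → Finset (Finset V)) (T : Finset V) : Prop where
  card : T.card = 4
  base : P 0 = T.ssubsets
  ear : ∀ j < t, ∃ τ bd, IsEarWithBoundary τ (P (j + 1)) bd ∧ partialUnion P j ∩ P (j + 1) = bd

theorem isSphereOfType_three_iff {Γ : Finset (Finset V)} :
    IsSphereOfType [3] Γ ↔ ∃ T : Finset V, T.card = 4 ∧ Γ = T.ssubsets := by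
  constructor
  · rintro ⟨L, hL, -, rfl⟩
    rcases L with _ | ⟨T, _ | ⟨_, _⟩⟩
    · simp at hL
    · exact ⟨T, by simpa using hL, by rw [boundaryJoin, boundaryJoin, join_empty_right]⟩
    · simp at hL
  · rintro ⟨T, hT, rfl⟩
    exact ⟨[T], by simp [hT], by simp, by rw [boundaryJoin, boundaryJoin, join_empty_right]⟩

theorem IsPSEarDecomposition.tetrahedral {Δ : Finset (Finset V)} {t : ℕ}
    {P : ℕ → Finset (Finset V)} (h : IsPSEarDecomposition 3 Δ t P)
    (h0 : IsSphereOfType [3] (P 0)) : ∃ T, IsTetrahedralDecomposition t P T := by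
  obtain ⟨T, hT, hP⟩ := isSphereOfType_three_iff.1 h0
  refine ⟨T, hT, hP, fun j hj => ?_⟩
  obtain ⟨bd, h1, h2⟩ := h.ear (j + 1) (by omega) (by omega)
  obtain ⟨τ, hτ⟩ := exists_isEarWithBoundary h1
  exact ⟨τ, bd, hτ, by rw [Finset.inter_comm]; exact h2⟩

namespace IsTetrahedralDecomposition

variable {t : ℕ} {P : ℕ → Finset (Finset V)} {T : Finset V}

theorem init (h : IsTetrahedralDecomposition (t + 1) P T) :
    IsTetrahedralDecomposition t P T :=
  ⟨h.card, h.base, fun j hj => h.ear j (by omega)⟩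

theorem isComplex (h : IsTetrahedralDecomposition t P T) : IsComplex (partialUnion P t) := by
  induction t with
  | zero =>
    rw [partialUnion_zero, h.base]
    exact isComplex_ssubsets T
  | succ t ih =>
    obtain ⟨τ, bd, hτ, -⟩ := h.ear t (by omega)
    rw [partialUnion_succ]
    exact (ih h.init).union hτ.isComplex

/-- Inclusion-exclusion: a new ear meets the earlier part in its boundary, hence contributes its
interior faces. -/
theorem fNum_eq (h : IsTetrahedralDecomposition t P T) {i : ℕ} (hi : i ≤ 3) :
    fNum (partialUnion P t) i = bdryF 4 i + earCount t P .A * earInterior .A i +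
      earCount t P .B * earInterior .B i + earCount t P .E * earInterior .E i +
      earCount t P .F * earInterior .F i := by
  induction t with
  | zero =>
    rw [partialUnion_zero, h.base, fNum_ssubsets, h.card]
    simp [earCount_zero]
  | succ t ih =>
    obtain ⟨τ, bd, hτ, hbd⟩ := h.ear t (by omega)
    have h1 := fNum_union_add_inter (partialUnion P t) (P (t + 1)) i
    rw [hbd, hτ.fNum_eq hi, ih h.init] at h1
    rw [partialUnion_succ]
    classical
    simp only [earCount_succ hτ]
    cases τ <;> simp <;> linarith

end IsTetrahedralDecomposition

/-! ### The vertices of an ear -/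

theorem IsComplex.fNum_one {Γ : Finset (Finset V)} (h : IsComplex Γ) :
    fNum Γ 1 = (verts Γ).card := by
  unfold fNum
  symm
  refine Finset.card_bij (fun u _ => {u}) ?_ ?_ ?_
  · intro u hu
    rw [Finset.mem_filter]
    exact ⟨h.mem_verts.1 hu, by simp⟩
  · intro u _ u' _ h
    simpa using h
  · intro F hF
    rw [Finset.mem_filter, Finset.card_eq_one] at hF
    obtain ⟨hF, u, rfl⟩ := hF
    exact ⟨u, h.mem_verts.2 hF, rfl⟩

/-- Ears of types A and B are cones over cycles: only the apex lies off the boundary, and it is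
adjacent to the whole cycle. -/
theorem IsEarWithBoundary.verts_of_cone {τ : EarType} {B bd : Finset (Finset V)}
    (h : IsEarWithBoundary τ B bd) (hτ : (earDims τ).1 = 0) :
    ∃ v, v ∉ verts bd ∧ verts B = insert v (verts bd) ∧ (verts bd).card = fNum bd 1 ∧
      ∀ u ∈ verts bd, {v, u} ∈ B := by
  obtain ⟨S, L, hS, hL, hd, rfl, rfl⟩ := h
  rw [hτ] at hS
  obtain ⟨v, rfl⟩ := Finset.card_eq_one.1 hS
  have hss : ({v} : Finset V).ssubsets = {∅} := by
    ext F; simp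
  have hL1 : ∀ T ∈ L, 1 ≤ T.card := by
    intro T hT
    have : T.card ∈ L.map Finset.card := List.mem_map_of_mem hT
    rw [hL] at this
    obtain ⟨m, -, hm⟩ := List.mem_map.1 this
    omega
  have hdis := disjoint_verts_boundaryJoin hd
  rw [hss, join_empty_left]
  refine ⟨v, by simpa using hdis, ?_, ?_, ?_⟩
  · rw [verts_join ⟨_, Finset.empty_mem_powerset _⟩ (boundaryJoin_nonempty hL1), verts_powerset]
    rfl
  · exact (isComplex_boundaryJoin L).fNum_one.symm
  · intro u hu
    exact mem_join.2 ⟨{v}, by simp, {u}, (isComplex_boundaryJoin L).mem_verts.1 hu, rfl⟩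

theorem IsEarWithBoundary.verts_of_not_cone {τ : EarType} {B bd : Finset (Finset V)}
    (h : IsEarWithBoundary τ B bd) (hτ : 1 ≤ (earDims τ).1) : verts B = verts bd := by
  obtain ⟨S, L, hS, hL, hd, rfl, rfl⟩ := h
  have hL1 : ∀ T ∈ L, 1 ≤ T.card := by
    intro T hT
    have : T.card ∈ L.map Finset.card := List.mem_map_of_mem hT
    rw [hL] at this
    obtain ⟨m, -, hm⟩ := List.mem_map.1 this
    omega
  rw [verts_join ⟨_, Finset.empty_mem_powerset _⟩ (boundaryJoin_nonempty hL1),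
    verts_join ⟨∅, Finset.empty_mem_ssubsets (Finset.card_pos.1 (by omega))⟩
      (boundaryJoin_nonempty hL1), verts_powerset, verts_ssubsets (by omega)]

/-! ### The bound on the number of triangles -/

/-- The members of a clique are inserted one at a time, each adjacent to all earlier ones; the size
restriction keeps the guaranteed degrees within c. -/
theorem SurplusBound.of_clique {G : Finset (Finset V)} {c : ℕ} {S : Finset V}
    (hS : ∀ u ∈ S, ∀ v ∈ S, u ≠ v → {u, v} ∈ G) (hc : S.card ≤ c + 1) :
    ∃ e, SurplusBound G c S (S.card.choose 2) (S.card.choose 3) e := by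
  induction S using Finset.induction_on with
  | empty => exact ⟨0, SurplusBound.empty c⟩
  | insert v S hv ih =>
    rw [Finset.card_insert_of_notMem hv] at hc ⊢
    obtain ⟨e, he⟩ := ih (fun u hu w hw => hS u (by simp [hu]) w (by simp [hw])) (by omega)
    rw [choose_two_succ, choose_three_succ]
    refine he.insert hv (by omega) ?_
    rw [nbrs, Finset.filter_true_of_mem]
    intro u hu
    exact hS v (by simp) u (by simp [hu]) (by rintro rfl; exact hv hu)

/-- Vertices are inserted in the order of the cone ears, but adjacency is taken in a fixed larger G,
so an edge is charged to its later endpoint even if an ear of type E creates it much later. Ears of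
types E and F bring no vertex and change nothing. An apex of type B has 4 neighbors in its boundary
cycle, of which c are counted as guaranteed. -/
theorem IsTetrahedralDecomposition.surplusBound {t : ℕ} {P : ℕ → Finset (Finset V)} {T : Finset V}
    (h : IsTetrahedralDecomposition t P T) {G : Finset (Finset V)} (hG : partialUnion P t ⊆ G)
    {c : ℕ} (h3 : 3 ≤ c) (h4 : c ≤ 4) :
    ∃ e, SurplusBound G c (verts (partialUnion P t))
      (6 + 3 * earCount t P .A + c * earCount t P .B)
      (4 + 3 * earCount t P .A + c.choose 2 * earCount t P .B) e := by
  induction t with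
  | zero =>
    rw [partialUnion_zero, h.base, verts_ssubsets (by rw [h.card]; omega), earCount_zero,
      earCount_zero]
    have := SurplusBound.of_clique (G := G) (c := c) (S := T) ?_ (by rw [h.card]; omega)
    · rw [h.card] at this
      exact this
    · intro u hu v hv huv
      refine hG ?_
      rw [partialUnion_zero, h.base, Finset.mem_ssubsets, Finset.ssubset_iff_subset_ne]
      refine ⟨by intro w; simp only [Finset.mem_insert, Finset.mem_singleton]
                 rintro (rfl | rfl) <;> assumption, ?_⟩
      intro he
      have := h.card
      rw [← he, Finset.card_pair huv] at this
      omega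
  | succ t ih =>
    obtain ⟨τ, bd, hτ, hbd⟩ := h.ear t (by omega)
    rw [partialUnion_succ] at hG ⊢
    obtain ⟨e, he⟩ := ih h.init (Finset.union_subset_left hG)
    have hsub : bd ⊆ partialUnion P t := hbd ▸ Finset.inter_subset_left
    have hvb := verts_mono hsub
    classical
    simp only [earCount_succ hτ]
    rw [verts_union]
    rcases Nat.eq_zero_or_pos (earDims τ).1 with h0 | h0
    · obtain ⟨v, hv, hvB, hcard, hvu⟩ := hτ.verts_of_cone h0
      -- An apex that was already present would lie in the intersection with the earlier part, which
      -- is the boundary of the ear.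
      have hvU : v ∉ verts (partialUnion P t) := by
        intro hv'
        have h1 : v ∈ verts (P (t + 1)) := by rw [hvB]; simp
        rw [h.init.isComplex.mem_verts] at hv'
        rw [hτ.isComplex.mem_verts] at h1
        refine hv (subset_verts (F := {v}) ?_ (by simp))
        rw [← hbd]
        exact Finset.mem_inter.2 ⟨hv', h1⟩
      have hN : fNum bd 1 ≤ (nbrs G v (verts (partialUnion P t))).card := by
        rw [← hcard]
        refine Finset.card_le_card fun u hu => ?_
        exact Finset.mem_filter.2 ⟨hvb hu, Finset.union_subset_right hG (hvu u hu)⟩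
      rw [(IsBallOfType.fNum hτ).2] at hN
      rw [hvB, Finset.union_insert, Finset.union_eq_left.2 hvb]
      cases τ with
      | A =>
        have h5 : conv (bdryF ((earDims .A).1 + 1)) (sphereF (earDims .A).2) 1 = 3 := by decide
        rw [h5] at hN
        obtain ⟨e', he'⟩ := he.insert hvU h3 hN
        refine ⟨e', ?_⟩
        convert he' using 1 <;> simp <;> ring
      | B =>
        have h5 : conv (bdryF ((earDims .B).1 + 1)) (sphereF (earDims .B).2) 1 = 4 := by decide
        rw [h5] at hN
        obtain ⟨e', he'⟩ := he.insert hvU le_rfl (h4.trans hN)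
        refine ⟨e', ?_⟩
        convert he' using 1 <;> simp <;> ring
      | E => simp [earDims] at h0
      | F => simp [earDims] at h0
    · rw [hτ.verts_of_not_cone h0, Finset.union_eq_left.2 hvb]
      refine ⟨e, ?_⟩
      cases τ with
      | A => simp [earDims] at h0
      | B => simp [earDims] at h0
      | E => simpa using he
      | F => simpa using he

theorem fNum_two (Γ : Finset (Finset V)) :
    fNum Γ 2 = edgeNum Γ (verts Γ) := by
  unfold fNum edgeNum
  congr 1
  ext F
  simp only [Finset.mem_filter, Finset.mem_powersetCard]
  exact ⟨fun ⟨h1, h2⟩ => ⟨⟨subset_verts h1, h2⟩, h1⟩, fun h => ⟨h.2, h.1.2⟩⟩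

theorem IsComplex.filter_three_subset {Γ : Finset (Finset V)} (h : IsComplex Γ) :
    (Γ.filter fun F => F.card = 3) ⊆ triangles Γ (verts Γ) := by
  intro F hF
  rw [Finset.mem_filter] at hF
  simp only [triangles, Finset.mem_filter, Finset.mem_powersetCard]
  exact ⟨⟨subset_verts hF.1, hF.2⟩, fun s hs => h hs.1 hF.1⟩

/-- The numerical consequences of a decomposition with tetrahedral base. -/
theorem IsTetrahedralDecomposition.bounds {t : ℕ} {P : ℕ → Finset (Finset V)} {T : Finset V}
    (h : IsTetrahedralDecomposition t P T) :
    (6 + 3 * earCount t P .A + 4 * earCount t P .B + earCount t P .E ≤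
      (4 + earCount t P .A + earCount t P .B).choose 2) ∧
    (4 + 3 * earCount t P .A + 4 * earCount t P .B + 2 * earCount t P .E + earCount t P .F ≤
      4 + 3 * earCount t P .A + 6 * earCount t P .B + 4 * earCount t P .E +
        kkTri (earCount t P .E)) ∧
    (4 + 3 * earCount t P .A + 4 * earCount t P .B + 2 * earCount t P .E + earCount t P .F ≤
      4 + 3 * earCount t P .A + 3 * earCount t P .B + 3 * (earCount t P .B + earCount t P .E) +
        kkTri (earCount t P .B + earCount t P .E)) := by
  have hc := h.isComplex
  have f1 := h.fNum_eq (i := 1) (by omega)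
  have f2 := h.fNum_eq (i := 2) (by omega)
  have f3 := h.fNum_eq (i := 3) (by omega)
  have b1 : bdryF 4 1 = 4 := by decide
  have b2 : bdryF 4 2 = 6 := by decide
  have b3 : bdryF 4 3 = 4 := by decide
  simp only [earInterior, List.getD_cons_succ, List.getD_cons_zero, b1, b2, b3] at f1 f2 f3
  have h3 := Finset.card_le_card hc.filter_three_subset
  change fNum _ 3 ≤ _ at h3
  refine ⟨?_, ?_, ?_⟩
  · have := edgeNum_le_choose (G := partialUnion P t) (verts (partialUnion P t))
    rw [← fNum_two, ← hc.fNum_one, f2, f1] at this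
    convert this using 1
    · ring
    · congr 1; ring
  -- The surplus is read off from the edge count: for c = 4 it is the number of ears of type E, and
  -- for c = 3 each ear of type B adds one more surplus edge.
  · obtain ⟨e, he⟩ := h.surplusBound (le_refl _) (by norm_num : 3 ≤ 4) le_rfl
    have h1 := he.edges
    have h2 := he.tri
    rw [← fNum_two] at h1
    obtain rfl : e = earCount t P .E := by omega
    simp only [show Nat.choose 4 2 = 6 from rfl] at h2
    omega
  · obtain ⟨e, he⟩ := h.surplusBound (le_refl _) le_rfl (by norm_num : 3 ≤ 4)
    have h1 := he.edges
    have h2 := he.tri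
    rw [← fNum_two] at h1
    obtain rfl : e = earCount t P .B + earCount t P .E := by omega
    simp only [show Nat.choose 3 2 = 3 from rfl] at h2
    omega

end EarDecompositions

/-! ### Assembling ear-decompositions; invariants of the ear numbers -/

section Building

variable {V : Type*} [DecidableEq V]

theorem IsPureComplex.rank_eq {V : Type*} {d : ℕ} {Δ : Finset (Finset V)}
    (h : IsPureComplex d Δ) : rank Δ = d := by
  obtain ⟨-, hne, hm⟩ := h
  refine rank_eq_of (fun F hF => ?_) ?_
  · obtain ⟨G, hFG, hG⟩ := Δ.exists_le_maximal hF
    exact (Finset.card_le_card hFG).trans (hm G hG).le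
  · obtain ⟨F, hF⟩ := hne
    obtain ⟨G, -, hG⟩ := Δ.exists_le_maximal hF
    exact ⟨G, hG.prop, hm G hG⟩

theorem isPureComplex_of_extend {V : Type*} {d : ℕ} {Δ : Finset (Finset V)} (h : IsComplex Δ)
    (hne : Δ.Nonempty) (hm : ∀ F ∈ Δ, ∃ G ∈ Δ, F ⊆ G ∧ G.card = d) : IsPureComplex d Δ := by
  refine ⟨h, hne, fun F hF => ?_⟩
  obtain ⟨G, hG, hFG, hd⟩ := hm F hF.prop
  rw [← hd, hF.eq_of_le hG hFG]

theorem IsPureComplex.extend {V : Type*} {d : ℕ} {Δ : Finset (Finset V)} (h : IsPureComplex d Δ)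
    {F : Finset V} (hF : F ∈ Δ) : ∃ G ∈ Δ, F ⊆ G ∧ G.card = d := by
  obtain ⟨G, hFG, hG⟩ := Δ.exists_le_maximal hF
  exact ⟨G, hG.prop, hFG, h.2.2 G hG⟩

theorem IsPureComplex.union {d : ℕ} {Γ Λ : Finset (Finset V)} (h : IsPureComplex d Γ)
    (h' : IsPureComplex d Λ) : IsPureComplex d (Γ ∪ Λ) := by
  refine isPureComplex_of_extend (h.1.union h'.1) (h.2.1.mono Finset.subset_union_left) ?_
  intro F hF
  rcases Finset.mem_union.1 hF with hF | hF
  · obtain ⟨G, hG, h1⟩ := h.extend hF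
    exact ⟨G, Finset.mem_union_left _ hG, h1⟩
  · obtain ⟨G, hG, h1⟩ := h'.extend hF
    exact ⟨G, Finset.mem_union_right _ hG, h1⟩

theorem isPureComplex_powerset {V : Type*} (S : Finset V) : IsPureComplex S.card S.powerset :=
  isPureComplex_of_extend (isComplex_powerset S) ⟨_, Finset.empty_mem_powerset S⟩
    fun _ hF => ⟨S, Finset.mem_powerset_self S, Finset.mem_powerset.1 hF, rfl⟩

theorem isPureComplex_ssubsets {S : Finset V} (h : 1 ≤ S.card) :
    IsPureComplex (S.card - 1) S.ssubsets := by
  refine isPureComplex_of_extend (isComplex_ssubsets S)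
    ⟨_, Finset.empty_mem_ssubsets (Finset.card_pos.1 h)⟩ fun F hF => ?_
  rw [Finset.mem_ssubsets] at hF
  obtain ⟨v, hv, hvF⟩ := Finset.exists_of_ssubset hF
  exact ⟨S.erase v, Finset.mem_ssubsets.2 (Finset.erase_ssubset hv),
    Finset.subset_erase.2 ⟨hF.1, hvF⟩, Finset.card_erase_of_mem hv⟩

theorem IsPureComplex.join {d d' : ℕ} {Γ Λ : Finset (Finset V)} (h : IsPureComplex d Γ)
    (h' : IsPureComplex d' Λ) (hd : Disjoint (verts Γ) (verts Λ)) :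
    IsPureComplex (d + d') (join Γ Λ) := by
  refine isPureComplex_of_extend (h.1.join h'.1) (h.2.1.image₂ h'.2.1) fun F hF => ?_
  obtain ⟨A, hA, B, hB, rfl⟩ := mem_join.1 hF
  obtain ⟨A', hA', hAA, hA3⟩ := h.extend hA
  obtain ⟨B', hB', hBB, hB3⟩ := h'.extend hB
  refine ⟨A' ∪ B', mem_join.2 ⟨A', hA', B', hB', rfl⟩, Finset.union_subset_union hAA hBB, ?_⟩
  rw [Finset.card_union_of_disjoint (hd.mono (subset_verts hA') (subset_verts hB')), hA3, hB3]

theorem isPureComplex_boundaryJoin {L : List (Finset V)} {dims : List ℕ}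
    (hL : L.map Finset.card = dims.map (· + 1)) (h : L.Pairwise Disjoint) :
    IsPureComplex dims.sum (boundaryJoin L) := by
  induction L generalizing dims with
  | nil =>
    rcases dims with _ | ⟨m, dims⟩
    · exact isPureComplex_of_extend (isComplex_boundaryJoin []) ⟨∅, by simp [boundaryJoin]⟩
        fun F hF => ⟨F, hF, le_rfl, by simpa [boundaryJoin] using hF⟩
    · simp at hL
  | cons S L ih =>
    rcases dims with _ | ⟨m, dims⟩
    · simp at hL
    · simp only [List.map_cons, List.cons.injEq] at hL
      have h1 := isPureComplex_ssubsets (S := S) (by omega)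
      rw [hL.1, Nat.add_sub_cancel] at h1
      exact h1.join (ih hL.2 (List.pairwise_cons.1 h).2)
        ((disjoint_verts_boundaryJoin h).mono_left (verts_ssubsets_subset S))

theorem IsEarWithBoundary.isPureComplex {τ : EarType} {B bd : Finset (Finset V)}
    (h : IsEarWithBoundary τ B bd) : IsPureComplex 3 B := by
  obtain ⟨S, L, hS, hL, hd, rfl, -⟩ := h
  have := (isPureComplex_powerset S).join
    (isPureComplex_boundaryJoin hL (List.pairwise_cons.1 hd).2)
    (by rw [verts_powerset]; exact disjoint_verts_boundaryJoin hd)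
  rw [hS] at this
  convert this using 1
  cases τ <;> rfl

theorem IsEarWithBoundary.isPSBall {τ : EarType} {B bd : Finset (Finset V)}
    (h : IsEarWithBoundary τ B bd) : IsPSBall 3 B bd :=
  ⟨h.isPureComplex.rank_eq, _, _, h⟩

/-- `C` has a PS ear-decomposition with tetrahedral base sphere and `η τ` ears of each type `τ`. -/
def HasEars (C : Finset (Finset V)) (η : EarType → ℕ) : Prop :=
  ∃ t Q, IsPSEarDecomposition 3 C t Q ∧ IsSphereOfType [3] (Q 0) ∧ earCount t Q = η

theorem hasEars_ssubsets {T : Finset V} (h : T.card = 4) : HasEars T.ssubsets fun _ => 0 := by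
  have hp : IsPureComplex 3 T.ssubsets := by
    have := isPureComplex_ssubsets (S := T) (by omega)
    rwa [h] at this
  have hs : IsSphereOfType [3] T.ssubsets := isSphereOfType_three_iff.2 ⟨T, h, rfl⟩
  refine ⟨0, fun _ => T.ssubsets, ⟨hp, by simp, ⟨hp.rank_eq, _, hs⟩, fun j h1 h2 => by omega⟩,
    hs, ?_⟩
  funext τ
  exact earCount_zero _ τ

theorem HasEars.add_ear {C : Finset (Finset V)} {η η' : EarType → ℕ} (h : HasEars C η)
    {τ : EarType} {B bd : Finset (Finset V)} (hB : IsEarWithBoundary τ B bd) (hbd : C ∩ B = bd)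
    (hτ : η' τ = η τ + 1) (hσ : ∀ σ, σ ≠ τ → η' σ = η σ) : HasEars (C ∪ B) η' := by
  classical
  obtain ⟨t, Q, hQ, h0, rfl⟩ := h
  have hold : ∀ j ≤ t, Function.update Q (t + 1) B j = Q j := fun j hj =>
    Function.update_of_ne (by omega) _ _
  have hun : ∀ j ≤ t + 1, (Finset.range j).biUnion (Function.update Q (t + 1) B) =
      (Finset.range j).biUnion Q := fun j hj =>
    Finset.biUnion_congr rfl fun i hi => hold i (by rw [Finset.mem_range] at hi; omega)
  refine ⟨t + 1, Function.update Q (t + 1) B, ⟨hQ.pure.union hB.isPureComplex, ?_, ?_, ?_⟩, ?_, ?_⟩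
  · rw [Finset.range_add_one, Finset.biUnion_insert, hun _ le_rfl, Function.update_self, ← hQ.union,
      Finset.union_comm]
  · rw [hold 0 (by omega)]
    exact hQ.sphere
  · intro j h1 h2
    rcases h2.lt_or_eq with h3 | rfl
    · rw [hun _ h2, hold j (by omega)]
      exact hQ.ear j h1 (by omega)
    · rw [hun _ le_rfl, Function.update_self, ← hQ.union, Finset.inter_comm]
      exact ⟨bd, hB.isPSBall, hbd⟩
  · rw [hold 0 (by omega)]
    exact h0
  · funext σ
    have hB' : IsEarWithBoundary τ (Function.update Q (t + 1) B (t + 1)) bd := by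
      rwa [Function.update_self]
    have hc : earCount t (Function.update Q (t + 1) B) σ = earCount t Q σ := by
      unfold earCount
      congr 1
      refine Finset.filter_congr fun j hj => ?_
      rw [hold j (Finset.mem_Icc.1 hj).2]
    rw [earCount_succ hB' σ, hc]
    split_ifs with h
    · rw [h, hτ]
    · rw [hσ σ h, add_zero]

/-- Each ear has exactly one type. Hence t is recovered from the ear numbers, and decompositions of
two complexes with equal ear numbers have the same length. -/
theorem IsTetrahedralDecomposition.sum_earCount {t : ℕ} {P : ℕ → Finset (Finset V)} {T : Finset V}
    (h : IsTetrahedralDecomposition t P T) :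
    t = earCount t P .A + earCount t P .B + earCount t P .E + earCount t P .F := by
  induction t with
  | zero => simp [earCount_zero]
  | succ t ih =>
    obtain ⟨τ, bd, hτ, -⟩ := h.ear t (by omega)
    have ih := ih h.init
    classical
    simp only [earCount_succ hτ]
    cases τ <;> simp <;> omega

theorem HasEars.bounds {C : Finset (Finset V)} {η : EarType → ℕ} (h : HasEars C η) :
    (6 + 3 * η .A + 4 * η .B + η .E ≤ (4 + η .A + η .B).choose 2) ∧
    (4 + 3 * η .A + 4 * η .B + 2 * η .E + η .F ≤
      4 + 3 * η .A + 6 * η .B + 4 * η .E + kkTri (η .E)) ∧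
    (4 + 3 * η .A + 4 * η .B + 2 * η .E + η .F ≤
      4 + 3 * η .A + 3 * η .B + 3 * (η .B + η .E) + kkTri (η .B + η .E)) := by
  obtain ⟨t, Q, hQ, h0, rfl⟩ := h
  obtain ⟨T, hT⟩ := hQ.tetrahedral h0
  exact hT.bounds

theorem HasEars.isPureComplex {C : Finset (Finset V)} {η : EarType → ℕ} (h : HasEars C η) :
    IsPureComplex 3 C := by
  obtain ⟨t, Q, hQ, -, -⟩ := h
  exact hQ.pure

theorem HasEars.fNum_eq {C : Finset (Finset V)} {η : EarType → ℕ} (h : HasEars C η) :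
    fNum C 0 = 1 ∧ fNum C 1 = 4 + η .A + η .B ∧ fNum C 2 = 6 + 3 * η .A + 4 * η .B + η .E ∧
      fNum C 3 = 4 + 3 * η .A + 4 * η .B + 2 * η .E + η .F := by
  obtain ⟨t, Q, hQ, h0, rfl⟩ := h
  obtain ⟨T, hT⟩ := hQ.tetrahedral h0
  have hC : partialUnion Q t = C := hQ.union.symm
  have f0 := hT.fNum_eq (i := 0) (by omega)
  have f1 := hT.fNum_eq (i := 1) (by omega)
  have f2 := hT.fNum_eq (i := 2) (by omega)
  have f3 := hT.fNum_eq (i := 3) (by omega)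
  have b0 : bdryF 4 0 = 1 := by decide
  have b1 : bdryF 4 1 = 4 := by decide
  have b2 : bdryF 4 2 = 6 := by decide
  have b3 : bdryF 4 3 = 4 := by decide
  simp only [earInterior, List.getD_cons_succ, List.getD_cons_zero, b0, b1, b2, b3, hC]
    at f0 f1 f2 f3
  omega

/-- The right side involves the ear numbers alone, so complexes with equal ear numbers have equal
h-vectors. -/
theorem HasEars.hVector_eq {C : Finset (Finset V)} {η : EarType → ℕ} (h : HasEars C η) :
    hVector C = [1, ((1 + η .A + η .B : ℕ) : ℤ), ((1 + η .A + 2 * η .B + η .E : ℕ) : ℤ),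
      ((1 + η .A + η .B + η .E + η .F : ℕ) : ℤ)] := by
  obtain ⟨f0, f1, f2, f3⟩ := h.fNum_eq
  rw [hVector, h.isPureComplex.rank_eq]
  simp only [List.range_succ, List.range_zero, List.nil_append, List.cons_append, List.map_cons,
    List.map_nil, hNum, Finset.sum_range_succ, Finset.sum_range_zero, f0, f1, f2, f3]
  norm_num [Nat.choose]
  refine ⟨?_, ?_, ?_⟩ <;> ring

theorem HasEars.exists_decomposition {C : Finset (Finset V)} {η : EarType → ℕ}
    (h : HasEars C η) :
    ∃ Q, IsPSEarDecomposition 3 C (η .A + η .B + η .E + η .F) Q ∧ IsSphereOfType [3] (Q 0) ∧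
      earCount (η .A + η .B + η .E + η .F) Q = η := by
  obtain ⟨t, Q, hQ, h0, rfl⟩ := h
  obtain ⟨T, hT⟩ := hQ.tetrahedral h0
  rw [← hT.sum_earCount]
  exact ⟨Q, hQ, h0, rfl⟩

end Building

/-! ### The revlex order -/

section Revlex

theorem RevlexLT.asymm {μ ν : Multiset ℕ} (h : RevlexLT μ ν) : ¬ RevlexLT ν μ := by
  rintro ⟨l, hl, hl'⟩
  obtain ⟨k, hk, hk'⟩ := h
  rcases lt_trichotomy k l with h | rfl | h
  · have := hk' l h; omega
  · omega
  · have := hl' k h; omega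

theorem RevlexLT.trans {μ ν ξ : Multiset ℕ} (h : RevlexLT μ ν) (h' : RevlexLT ν ξ) :
    RevlexLT μ ξ := by
  obtain ⟨k, hk, hk'⟩ := h
  obtain ⟨l, hl, hl'⟩ := h'
  rcases lt_trichotomy k l with h | rfl | h
  · exact ⟨l, (hk' l h).trans_lt hl, fun m hm => (hk' m (h.trans hm)).trans (hl' m hm)⟩
  · exact ⟨k, hk.trans hl, fun m hm => (hk' m hm).trans (hl' m hm)⟩
  · exact ⟨k, hk.trans_eq (hl' k h), fun m hm => (hk' m hm).trans (hl' m (h.trans hm))⟩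

theorem revlexLT_or_revlexLT {μ ν : Multiset ℕ} (h : μ ≠ ν) : RevlexLT μ ν ∨ RevlexLT ν μ := by
  obtain ⟨x, hx⟩ : ∃ x, μ.count x ≠ ν.count x := by
    by_contra! hc
    exact h (Multiset.ext.2 hc)
  have hmem : ∀ y, μ.count y ≠ ν.count y →
      y ∈ (μ + ν).toFinset.filter fun y => μ.count y ≠ ν.count y := by
    intro y hy
    rw [Finset.mem_filter, Multiset.mem_toFinset, ← Multiset.count_pos, Multiset.count_add]
    exact ⟨by omega, hy⟩
  obtain ⟨k, hk, hmax⟩ := Finset.exists_max_image _ id ⟨x, hmem x hx⟩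
  have hne := (Finset.mem_filter.1 hk).2
  have heq : ∀ l, k < l → μ.count l = ν.count l := by
    intro l hl
    by_contra hc
    exact absurd (hmax l (hmem l hc)) (not_le.2 hl)
  rcases hne.lt_or_gt with h | h
  · exact .inl ⟨k, h, heq⟩
  · exact .inr ⟨k, h, fun l hl => (heq l hl).symm⟩

theorem exists_revlexLT_least {s : Set (Multiset ℕ)} (hs : s.Finite) (hne : s.Nonempty) :
    ∃ μ ∈ s, ∀ ν ∈ s, ν ≠ μ → RevlexLT μ ν := by
  induction s, hs using Set.Finite.induction_on with
  | empty => exact absurd hne Set.not_nonempty_empty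
  | @insert μ s _ _ ih =>
    rcases s.eq_empty_or_nonempty with rfl | h
    · exact ⟨μ, by simp, fun ν hν hne => absurd (by simpa using hν) hne⟩
    · obtain ⟨ξ, hξ, hl⟩ := ih h
      by_cases hμ : ξ = μ
      · subst hμ
        exact ⟨ξ, by simp, fun ν hν hne => hl ν (hν.resolve_left hne) hne⟩
      rcases revlexLT_or_revlexLT hμ with h' | h'
      · refine ⟨ξ, by simp [hξ], fun ν hν hne => ?_⟩
        rcases hν with rfl | hν
        exacts [h', hl ν hν hne]
      · refine ⟨μ, by simp, fun ν hν hne => ?_⟩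
        have hν := hν.resolve_left hne
        by_cases hc : ν = ξ
        · rwa [hc]
        · exact h'.trans (hl ν hν hc)

/-- The largest index of disagreement is examined first, so the revlex smallest missing edge has the
smallest possible larger endpoint. -/
theorem RevlexLT.of_pair {i j i' j' : ℕ} (hij : i < j) (hij' : i' < j')
    (h : RevlexLT ({i, j} : Finset ℕ).val ({i', j'} : Finset ℕ).val) :
    j < j' ∨ j = j' ∧ i < i' := by
  obtain ⟨k, hk, hl⟩ := h
  have key : ∀ (s : Finset ℕ) (l : ℕ), Multiset.count l s.val = if l ∈ s then 1 else 0 :=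
    fun s l => by rw [Multiset.count_eq_of_nodup s.nodup]; rfl
  simp only [key, Finset.mem_insert, Finset.mem_singleton] at hk hl
  have hk1 : ¬ (k = i ∨ k = j) := by
    intro hc
    rw [if_pos hc] at hk
    split_ifs at hk <;> omega
  have hk2 : k = i' ∨ k = j' := by
    by_contra hc
    rw [if_neg hc] at hk
    omega
  have hl' : ∀ l, k < l → (l = i ∨ l = j ↔ l = i' ∨ l = j') := by
    intro l h
    have := hl l h
    split_ifs at this <;> simp_all
  have h1 := hl' j
  have h2 := hl' j'
  have h3 := hl' i
  have h4 := hl' i'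
  omega

end Revlex

/-! ### Determinism and iteration of the steps -/

section Steps

theorem IsLeastMissingFace.eq {C : Finset (Finset ℕ)} {m : ℕ} {G G' : Finset ℕ}
    (h : IsLeastMissingFace C m G) (h' : IsLeastMissingFace C m G') : G = G' := by
  by_contra hne
  exact (h.2 G' h'.1.1 h'.1.2 (Ne.symm hne)).asymm (h'.2 G h.1.1 h.1.2 hne)

theorem IsLeastAvailable.eq {M : Finset (Multiset ℕ)} {m : ℕ} {μ ν : Multiset ℕ}
    (h : IsLeastAvailable M m μ) (h' : IsLeastAvailable M m ν) : μ = ν := by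
  by_contra hne
  exact (h.2 ν h'.1.1 h'.1.2 (Ne.symm hne)).asymm (h'.2 μ h.1.1 h.1.2 hne)

/-- For m ≥ 2 every vertex of a missing face is a proper subset and thus a face, so missing faces
live on the finite vertex set of `C` and a least one exists. -/
theorem exists_isLeastMissingFace {C : Finset (Finset ℕ)} {m : ℕ} (hm : 2 ≤ m)
    (h : ∃ G : Finset ℕ, G.card = m ∧ IsMissingFace C G) : ∃ G, IsLeastMissingFace C m G := by
  have hfin : {G : Finset ℕ | G.card = m ∧ IsMissingFace C G}.Finite := by
    refine (verts C).powerset.finite_toSet.subset fun G hG => ?_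
    rw [Finset.mem_coe, Finset.mem_powerset]
    intro v hv
    refine subset_verts (F := {v}) (hG.2.2 _ ?_) (by simp)
    refine Finset.ssubset_iff_subset_ne.2 ⟨by simpa using hv, ?_⟩
    intro he
    have := hG.1
    rw [← he, Finset.card_singleton] at this
    omega
  obtain ⟨μ, ⟨G, hG, rfl⟩, hl⟩ :=
    exists_revlexLT_least (hfin.image Finset.val) (Set.Nonempty.image _ h)
  exact ⟨G, hG, fun G' h1 h2 hne =>
    hl _ ⟨G', ⟨h1, h2⟩, rfl⟩ fun he => hne (Finset.val_injective he)⟩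

/-- For m ≥ 2 an available monomial is the product of two members of `M`, a variable and the
complementary divisor, so there are finitely many. -/
theorem exists_isLeastAvailable {M : Finset (Multiset ℕ)} {m : ℕ} (hm : 2 ≤ m)
    (h : ∃ μ : Multiset ℕ, Multiset.card μ = m ∧ IsAvailable M μ) :
    ∃ μ, IsLeastAvailable M m μ := by
  have hfin : {μ : Multiset ℕ | Multiset.card μ = m ∧ IsAvailable M μ}.Finite := by
    refine (Set.Finite.image2 (· + ·) M.finite_toSet M.finite_toSet).subset fun μ hμ => ?_
    obtain ⟨x, hx⟩ : ∃ x, x ∈ μ := Multiset.card_pos_iff_exists_mem.1 (by rw [hμ.1]; omega)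
    refine ⟨{x}, hμ.2.2 _ ?_, μ.erase x, hμ.2.2 _ (Multiset.erase_lt.2 hx), ?_⟩
    · refine lt_of_le_of_ne (Multiset.singleton_le.2 hx) fun he => ?_
      have := hμ.1
      rw [← he, Multiset.card_singleton] at this
      omega
    · simp only [Multiset.singleton_add]
      exact Multiset.cons_erase hx
  obtain ⟨μ, hμ, hl⟩ := exists_revlexLT_least hfin h
  exact ⟨μ, hμ, fun ν h1 h2 => hl ν ⟨h1, h2⟩⟩

theorem State.ext' {s s' : State} (h : s.complex = s'.complex) (h' : s.monomials = s'.monomials) :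
    s = s' := by
  cases s; cases s'; simp_all

theorem EStep.eq {s u u' : State} (h : EStep s u) (h' : EStep s u') : u = u' := by
  obtain ⟨i, j, hij, hl, hc, hm⟩ := h
  obtain ⟨i', j', hij', hl', hc', hm'⟩ := h'
  have he := hl.eq hl'
  have h1 : i ∈ ({i', j'} : Finset ℕ) := by rw [← he]; simp
  have h2 : j ∈ ({i', j'} : Finset ℕ) := by rw [← he]; simp
  simp only [Finset.mem_insert, Finset.mem_singleton] at h1 h2
  obtain ⟨rfl, rfl⟩ : i = i' ∧ j = j' := by omega
  exact State.ext' (hc.trans hc'.symm) (hm.trans hm'.symm)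

theorem FStep.eq {s u u' : State} (h : FStep s u) (h' : FStep s u') : u = u' := by
  obtain ⟨G, μ, hl, ha, hc, hm⟩ := h
  obtain ⟨G', μ', hl', ha', hc', hm'⟩ := h'
  obtain rfl := hl.eq hl'
  obtain rfl := ha.eq ha'
  exact State.ext' (hc.trans hc'.symm) (hm.trans hm'.symm)

/-- An invariant that guarantees the next step yields a full run, and determinism of `R` makes it
the only one. -/
theorem exists_iterate {R : State → State → Prop} (hR : ∀ s u u', R s u → R s u' → u = u')
    {Inv : ℕ → State → Prop} {N : ℕ} {s : State} (h0 : Inv 0 s)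
    (hstep : ∀ k < N, ∀ u, Inv k u → ∃ u', R u u' ∧ Inv (k + 1) u') :
    ∃ u, Inv N u ∧ iterate R N s u ∧ ∀ v, iterate R N s v → v = u := by
  induction N with
  | zero => exact ⟨s, h0, rfl, fun v hv => hv.symm⟩
  | succ N ih =>
    obtain ⟨u, hu, hi, huniq⟩ := ih fun k hk => hstep k (by omega)
    obtain ⟨u', hR', hu'⟩ := hstep N (by omega) u hu
    refine ⟨u', hu', ⟨u, hi, hR'⟩, ?_⟩
    rintro v ⟨z, hz, hv⟩
    obtain rfl := huniq z hz
    exact hR _ _ _ hv hR'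

end Steps

/-! ### Degree profiles of the compressed graph -/

section Profiles

/-- The number of earlier neighbors of the vertex `v_j` after Step 1. -/
def baseDeg (b j : ℕ) : ℕ :=
  if j ≤ 4 then j - 1 else if j ≤ b + 4 then 4 else 3

/-- `D j` is the number of earlier neighbors of the vertex `v_j` after Step 2: the vertices before
`v_p` are pairwise adjacent and those after `v_p` have received no edges in Step 2. -/
structure Profile (a b e : ℕ) (D : ℕ → ℕ) (p : ℕ) : Prop where
  four_le : 4 ≤ p
  five_le : 0 < b → 5 ≤ p
  le_last : p ≤ a + b + 4
  below : ∀ j < p, D j = j - 1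
  above : ∀ j, p < j → D j = baseDeg b j
  lower : baseDeg b p ≤ D p
  upper : D p ≤ p - 1
  sum : ∑ j ∈ Finset.range (a + b + 5), D j = 6 + 3 * a + 4 * b + e

/-- Beyond v_p there remain b + 4 - p apices of type B and a of type A. The function `g` is the
identity for counting edges and C(·,2) for counting triangles. -/
theorem sum_baseDeg (g : ℕ → ℕ) {a b p m : ℕ} (h4 : 4 ≤ p) (hp : p ≤ b + 4)
    (hm : p + m = a + b + 4) :
    ∑ i ∈ Finset.range m, g (baseDeg b (p + 1 + i)) = g 4 * (b + 4 - p) + g 3 * a := by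
  obtain rfl : m = (b + 4 - p) + a := by omega
  rw [Finset.sum_range_add]
  congr 1
  · rw [Finset.sum_congr rfl (g := fun _ => g 4)]
    · simp [mul_comm]
    · intro i hi
      rw [Finset.mem_range] at hi
      rw [baseDeg, if_neg (by omega), if_pos (by omega)]
  · rw [Finset.sum_congr rfl (g := fun _ => g 3)]
    · simp [mul_comm]
    · intro i hi
      rw [baseDeg, if_neg (by omega), if_neg (by omega)]

theorem sum_baseDeg_of_le (g : ℕ → ℕ) {b p m : ℕ} (hp : b + 4 ≤ p) :
    ∑ i ∈ Finset.range m, g (baseDeg b (p + 1 + i)) = g 3 * m := by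
  rw [Finset.sum_congr rfl (g := fun _ => g 3)]
  · simp [mul_comm]
  · intro i hi
    rw [baseDeg, if_neg (by omega), if_neg (by omega)]

/-- The index 0 belongs to no vertex; truncated subtraction makes its term vanish. -/
theorem sum_range_pred (p : ℕ) : ∑ j ∈ Finset.range (p + 1), (j - 1) = p.choose 2 := by
  induction p with
  | zero => simp
  | succ p ih => rw [Finset.sum_range_succ, ih, choose_two_succ]; simp

theorem sum_range_pred_choose (p : ℕ) :
    ∑ j ∈ Finset.range (p + 1), (j - 1).choose 2 = p.choose 3 := by
  induction p with
  | zero => simp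
  | succ p ih => rw [Finset.sum_range_succ, ih, choose_three_succ]; simp

theorem profile_baseDeg (a b : ℕ) :
    Profile a b 0 (baseDeg b) (if b = 0 then 4 else 5) := by
  have hs : ∑ j ∈ Finset.range (a + b + 5), baseDeg b j = 6 + 3 * a + 4 * b + 0 := by
    rw [show a + b + 5 = 5 + (a + b) by ring, Finset.sum_range_add,
      sum_baseDeg (fun x => x) (a := a) (p := 4) le_rfl (by omega) (by omega)]
    simp [Finset.sum_range_succ, baseDeg]
    omega
  split_ifs with hb
  · subst hb
    refine ⟨le_rfl, by omega, by omega, fun j hj => ?_, fun j _ => rfl, le_rfl, by simp [baseDeg],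
      hs⟩
    rw [baseDeg, if_pos (by omega)]
  · refine ⟨by omega, by omega, by omega, fun j hj => ?_, fun j _ => rfl, le_rfl, ?_, hs⟩
    · rw [baseDeg, if_pos (by omega)]
    · rw [baseDeg, if_neg (by omega), if_pos (by omega)]

namespace Profile

variable {a b e p : ℕ} {D : ℕ → ℕ}

theorem three_le (h : Profile a b e D p) {j : ℕ} (hj : 4 ≤ j) : 3 ≤ D j := by
  have hb : 3 ≤ baseDeg b j := by
    unfold baseDeg
    split_ifs <;> omega
  rcases lt_trichotomy j p with h1 | rfl | h1
  · rw [h.below j h1]; omega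
  · exact hb.trans h.lower
  · rwa [h.above j h1]

theorem le_pred (h : Profile a b e D p) (j : ℕ) : D j ≤ j - 1 := by
  rcases lt_trichotomy j p with h1 | rfl | h1
  · exact (h.below j h1).le
  · exact h.upper
  · rw [h.above j h1, baseDeg]
    split_ifs <;> omega

/-- Since k ≤ D j, either k ≤ 4 or k < p, and in both cases v_k is adjacent to all earlier vertices.
The earlier neighbors of v_j therefore form a clique, and C(D j, 2) triangles have v_j as last
vertex. -/
theorem initial_clique (h : Profile a b e D p) {i j k : ℕ} (hik : i < k) (hkj : k ≤ D j) :
    i ≤ D k := by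
  rcases le_or_gt k 4 with hk | hk
  · rcases hk.lt_or_eq with hk | rfl
    · rw [h.below k (by have := h.four_le; omega)]
      omega
    · have := h.three_le (le_refl 4)
      omega
  · rcases le_or_gt j p with h1 | h1
    · have := h.le_pred j
      rw [h.below k (by omega)]
      omega
    · rw [h.above j h1, baseDeg] at hkj
      have := h.four_le
      split_ifs at hkj <;> omega

theorem split (h : Profile a b e D p) (g : ℕ → ℕ) :
    ∑ j ∈ Finset.range (a + b + 5), g (D j) = ∑ j ∈ Finset.range p, g (j - 1) + g (D p) +
      ∑ i ∈ Finset.range (a + b + 4 - p), g (baseDeg b (p + 1 + i)) := by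
  have := h.le_last
  obtain ⟨m, hm⟩ : ∃ m, a + b + 5 = p + 1 + m := ⟨a + b + 4 - p, by omega⟩
  rw [hm, Finset.sum_range_add, Finset.sum_range_succ, show a + b + 4 - p = m by omega]
  congr 2
  · exact Finset.sum_congr rfl fun j hj => by rw [h.below j (Finset.mem_range.1 hj)]
  · funext i
    rw [h.above _ (by omega)]

theorem choose_three_add_three (k : ℕ) :
    (k + 3).choose 3 = k.choose 3 + 3 * k.choose 2 + 3 * k + 1 := by
  have h1 := choose_three_succ (k + 1 + 1)
  rw [choose_three_succ (k + 1), choose_three_succ k, choose_two_succ (k + 1),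
    choose_two_succ k] at h1
  rw [show k + 3 = k + 1 + 1 + 1 from rfl, h1]
  ring

/-- The number of triangles in the compressed graph attains the Kruskal-Katona bound. -/
theorem le_sum_choose (h : Profile a b e D p) {N : ℕ}
    (h1 : N ≤ 4 + 3 * a + 6 * b + 4 * e + kkTri e)
    (h2 : N ≤ 4 + 3 * a + 3 * b + 3 * (b + e) + kkTri (b + e)) :
    N ≤ ∑ j ∈ Finset.range (a + b + 5), (D j).choose 2 := by
  have hs := h.sum
  have hlast := h.le_last
  have hup := h.upper
  have h4 := h.four_le
  have h3 := h.three_le h4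
  rw [h.split fun x => x] at hs
  rw [h.split fun x => x.choose 2]
  -- If p ≥ b + 4, all vertices after v_p have 3 earlier neighbors and the bound with c = 3 is
  -- attained; otherwise apices of type B with only 4 remain and the bound with c = 4 is attained.
  rcases le_or_gt (b + 4) p with hp | hp
  · rw [sum_baseDeg_of_le (fun x => x) hp] at hs
    rw [sum_baseDeg_of_le (fun x => x.choose 2) hp]
    obtain ⟨k, rfl⟩ : ∃ k, p = k + 3 + 1 := ⟨p - 4, by omega⟩
    obtain ⟨r, hr⟩ : ∃ r, D (k + 3 + 1) = r + 3 := ⟨D (k + 3 + 1) - 3, by omega⟩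
    rw [sum_range_pred, hr, choose_two_add] at hs
    rw [sum_range_pred_choose, choose_three_add_three, hr, choose_two_add r]
    simp only [show Nat.choose 3 2 = 3 from rfl] at hs ⊢
    -- The edge count identifies the surplus: v_p is short of saturation by k - r, so (k, r) is the
    -- representation used by `kkTri`, with r ≤ k because D p ≤ p - 1.
    have he : b + e = k.choose 2 + r := by omega
    rw [he, kkTri_of_le (by omega)] at h2
    omega
  · have hb : 5 ≤ p := h.five_le (by omega)
    have hD : 4 ≤ D p := by
      have := h.lower
      rwa [baseDeg, if_neg (by omega), if_pos (by omega)] at this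
    rw [sum_baseDeg (fun x => x) (a := a) h4 hp.le (by omega)] at hs
    rw [sum_baseDeg (fun x => x.choose 2) (a := a) h4 hp.le (by omega)]
    obtain ⟨k, rfl⟩ : ∃ k, p = k + 4 + 1 := ⟨p - 5, by omega⟩
    obtain ⟨r, hr⟩ : ∃ r, D (k + 4 + 1) = r + 4 := ⟨D (k + 4 + 1) - 4, by omega⟩
    rw [sum_range_pred, hr, choose_two_add] at hs
    rw [sum_range_pred_choose, choose_three_succ, choose_three_add_three, choose_two_add k 3, hr,
      choose_two_add r]
    simp only [show Nat.choose 3 2 = 3 from rfl, show Nat.choose 4 2 = 6 from rfl] at hs ⊢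
    have he : e = k.choose 2 + r := by omega
    have hk := kkTri_of_le (show r ≤ k by omega)
    rw [← he] at hk
    rw [hk] at h1
    omega

/-- Raising the first entry that can be raised. -/
theorem update (h : Profile a b e D p) {j : ℕ} (hjn : j ≤ a + b + 4) (hj : D j < j - 1)
    (hbelow : ∀ k < j, D k = k - 1) :
    Profile a b (e + 1) (Function.update D j (D j + 1)) j := by
  have hpj : p ≤ j := by
    by_contra hc
    have := h.below j (by omega)
    omega
  have hbase : baseDeg b j ≤ D j := by
    rcases hpj.lt_or_eq with h1 | rfl
    · exact (h.above j h1).ge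
    · exact h.lower
  have h4 := h.four_le
  refine ⟨by omega, fun hb => (h.five_le hb).trans hpj, hjn, fun k hk => ?_, fun k hk => ?_, ?_, ?_,
    ?_⟩
  · rw [Function.update_of_ne (by omega), hbelow k hk]
  · rw [Function.update_of_ne (by omega), h.above k (by omega)]
  · rw [Function.update_self]; omega
  · rw [Function.update_self]; omega
  · have hm : j ∈ Finset.range (a + b + 5) := by rw [Finset.mem_range]; omega
    have hs := h.sum
    rw [← Finset.sum_erase_add _ _ hm] at hs
    rw [Finset.sum_update_of_mem hm, ← Finset.erase_eq]
    omega

/-- If every vertex were saturated, the graph would be complete and the edge count too large. -/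
theorem exists_lt (h : Profile a b e D p)
    (he : 6 + 3 * a + 4 * b + e < (4 + a + b).choose 2) : ∃ j ≤ a + b + 4, D j < j - 1 := by
  by_contra! hc
  have hs : ∑ j ∈ Finset.range (a + b + 5), D j = ∑ j ∈ Finset.range (a + b + 4 + 1), (j - 1) :=
    Finset.sum_congr rfl fun j hj =>
      le_antisymm (h.le_pred j) (hc j (by rw [Finset.mem_range] at hj; omega))
  rw [h.sum, sum_range_pred, show a + b + 4 = 4 + a + b by ring] at hs
  omega

end Profile

end Profiles

/-! ### Attaching a ball along its boundary -/

section AddBall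

variable {V : Type*} [DecidableEq V]

theorem mem_join_powerset {S : Finset V} {Λ : Finset (Finset V)} (h : Disjoint S (verts Λ))
    {F : Finset V} : F ∈ join S.powerset Λ ↔ F \ S ∈ Λ := by
  rw [mem_join]
  constructor
  · rintro ⟨A, hA, B, hB, rfl⟩
    have hd : Disjoint B S := (h.mono_right (subset_verts hB)).symm
    rwa [Finset.union_sdiff_distrib, Finset.sdiff_eq_empty_iff_subset.2 (Finset.mem_powerset.1 hA),
      Finset.empty_union, Finset.sdiff_eq_self_of_disjoint hd]
  · intro hF
    exact ⟨F ∩ S, Finset.mem_powerset.2 Finset.inter_subset_right, _, hF,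
      by rw [Finset.union_comm, Finset.sdiff_union_inter]⟩

theorem mem_join_ssubsets {S : Finset V} {Λ : Finset (Finset V)} (h : Disjoint S (verts Λ))
    {F : Finset V} : F ∈ join S.ssubsets Λ ↔ F \ S ∈ Λ ∧ ¬ S ⊆ F := by
  constructor
  · intro hF
    refine ⟨(mem_join_powerset h).1 ?_, fun hSF => ?_⟩
    · obtain ⟨A, hA, B, hB, rfl⟩ := mem_join.1 hF
      exact mem_join.2 ⟨A, Finset.mem_powerset.2 (Finset.mem_ssubsets.1 hA).1, B, hB, rfl⟩
    · obtain ⟨A, hA, B, hB, rfl⟩ := mem_join.1 hF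
      refine (Finset.mem_ssubsets.1 hA).2 fun x hx => ?_
      refine (Finset.mem_union.1 (hSF hx)).resolve_right fun hxB => ?_
      exact Finset.disjoint_left.1 h hx (subset_verts hB hxB)
  · rintro ⟨hF, hSF⟩
    refine mem_join.2 ⟨F ∩ S, Finset.mem_ssubsets.2 ⟨Finset.inter_subset_right, fun hc => ?_⟩, _, hF,
      by rw [Finset.union_comm, Finset.sdiff_union_inter]⟩
    exact hSF (hc.trans Finset.inter_subset_left)

/-- A face of the ball that does not contain S lies in its boundary and hence already in `C`. -/
theorem mem_union_ball {S : Finset V} {Λ C : Finset (Finset V)} (h : Disjoint S (verts Λ))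
    (hbd : join S.ssubsets Λ ⊆ C) {F : Finset V} :
    F ∈ C ∪ join S.powerset Λ ↔ F ∈ C ∨ S ⊆ F ∧ F \ S ∈ Λ := by
  rw [Finset.mem_union, mem_join_powerset h]
  constructor
  · rintro (hF | hF)
    · exact .inl hF
    · by_cases hS : S ⊆ F
      · exact .inr ⟨hS, hF⟩
      · exact .inl (hbd ((mem_join_ssubsets h).2 ⟨hF, hS⟩))
  · rintro (hF | hF)
    exacts [.inl hF, .inr hF.2]

/-- `C` is closed under subsets and omits S, so no face of `C` contains S; the faces of the ball not
containing S form its boundary. -/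
theorem inter_ball {S : Finset V} {Λ C : Finset (Finset V)} (h : Disjoint S (verts Λ))
    (hC : IsComplex C) (hS : S ∉ C) (hbd : join S.ssubsets Λ ⊆ C) :
    C ∩ join S.powerset Λ = join S.ssubsets Λ := by
  ext F
  rw [Finset.mem_inter, mem_join_powerset h, mem_join_ssubsets h]
  constructor
  · rintro ⟨hF, hF'⟩
    exact ⟨hF', fun hSF => hS (hC hSF hF)⟩
  · intro hF
    exact ⟨hbd ((mem_join_ssubsets h).2 hF), hF.1⟩

theorem HasEars.add_ball {C : Finset (Finset V)} {η η' : EarType → ℕ} (h : HasEars C η)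
    (τ : EarType) {S : Finset V} {L : List (Finset V)} (hS : S.card = (earDims τ).1 + 1)
    (hL : L.map Finset.card = (earDims τ).2.map (· + 1)) (hd : (S :: L).Pairwise Disjoint)
    (hSC : S ∉ C) (hbd : join S.ssubsets (boundaryJoin L) ⊆ C)
    (hτ : η' τ = η τ + 1) (hσ : ∀ σ, σ ≠ τ → η' σ = η σ) :
    HasEars (C ∪ join S.powerset (boundaryJoin L)) η' :=
  h.add_ear (τ := τ) ⟨S, L, hS, hL, hd, rfl, rfl⟩
    (inter_ball (disjoint_verts_boundaryJoin hd) h.isPureComplex.1 hSC hbd) hτ hσ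

end AddBall

/-! ### The complex built by the algorithm -/

section CompressedComplex

/-- The numbers of ears of the four types, as a function of the type. -/
def counts (a b e f : ℕ) : EarType → ℕ
  | .A => a
  | .B => b
  | .E => e
  | .F => f

/-- An ear-decomposable complex on the vertices `v_1, ..., v_{a+b+4}`, in which the neighbors of
`v_j` preceding it are `v_1, ..., v_{D j}`. -/
structure IsCompressedComplex (a b e f : ℕ) (D : ℕ → ℕ) (C : Finset (Finset ℕ)) : Prop where
  ears : HasEars C (counts a b e f)
  vertex : ∀ i, {i} ∈ C ↔ 1 ≤ i ∧ i ≤ a + b + 4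
  edge : ∀ i j, i < j → ({i, j} ∈ C ↔ 1 ≤ i ∧ i ≤ D j ∧ j ≤ a + b + 4)

theorem boundaryJoin_singleton {V : Type*} [DecidableEq V] (S : Finset V) :
    boundaryJoin [S] = S.ssubsets := by
  rw [boundaryJoin, boundaryJoin, join_empty_right]

theorem mem_ssubsets_tetrahedron {F : Finset ℕ} (h : F.card < 4) :
    F ∈ ({1, 2, 3, 4} : Finset ℕ).ssubsets ↔ ∀ i ∈ F, 1 ≤ i ∧ i ≤ 4 := by
  rw [Finset.mem_ssubsets, Finset.ssubset_iff_subset_ne, and_iff_left]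
  · refine forall₂_congr fun i _ => ?_
    simp only [Finset.mem_insert, Finset.mem_singleton]
    omega
  · rintro rfl
    simp at h

theorem IsCompressedComplex.tetrahedron {D : ℕ → ℕ} (hD : ∀ j ≤ 4, D j = j - 1) :
    IsCompressedComplex 0 0 0 0 D (boundaryJoin [{1, 2, 3, 4}]) := by
  rw [boundaryJoin_singleton]
  refine ⟨?_, fun i => ?_, fun i j hij => ?_⟩
  · convert hasEars_ssubsets (T := ({1, 2, 3, 4} : Finset ℕ)) rfl using 1
    funext τ
    cases τ <;> rfl
  · rw [mem_ssubsets_tetrahedron (by simp)]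
    simp
  · rw [mem_ssubsets_tetrahedron (lt_of_le_of_lt Finset.card_le_two (by omega))]
    simp only [Finset.mem_insert, Finset.mem_singleton, forall_eq_or_imp, forall_eq]
    constructor
    · rintro ⟨h1, h2⟩
      rw [hD j h2.2]
      omega
    · rintro ⟨h1, h2, h3⟩
      omega

/-- Covers both cases of Step 1. The new vertex is v_{a+b+5}, and `hD` says that the base cycle has
the vertices prescribed by the profile. -/
theorem IsCompressedComplex.cone {a b a' b' : ℕ} {D : ℕ → ℕ} {C : Finset (Finset ℕ)}
    (h : IsCompressedComplex a b 0 0 D C) (τ : EarType) (hτ : (earDims τ).1 = 0)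
    {L : List (Finset ℕ)} (hL : L.map Finset.card = (earDims τ).2.map (· + 1))
    (hd : L.Pairwise Disjoint) (hLC : boundaryJoin L ⊆ C)
    (hcount : counts a' b' 0 0 τ = counts a b 0 0 τ + 1)
    (hcount' : ∀ σ, σ ≠ τ → counts a' b' 0 0 σ = counts a b 0 0 σ) (hab : a' + b' = a + b + 1)
    (hlist : ∀ S ∈ L, ∀ i ∈ S, i ≤ 4)
    (hD : ∀ i, {i} ∈ boundaryJoin L ↔ 1 ≤ i ∧ i ≤ D (a + b + 5)) :
    IsCompressedComplex a' b' 0 0 D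
      (C ∪ join (Finset.powerset {a + b + 5}) (boundaryJoin L)) := by
  have hd' : ({a + b + 5} :: L).Pairwise Disjoint := by
    refine List.pairwise_cons.2 ⟨fun S hS => ?_, hd⟩
    rw [Finset.disjoint_singleton_left]
    intro hc
    have := hlist S hS _ hc
    omega
  have hdis := disjoint_verts_boundaryJoin hd'
  have hv : {a + b + 5} ∉ C := by
    rw [h.vertex]
    omega
  have hbd : join (Finset.ssubsets {a + b + 5}) (boundaryJoin L) ⊆ C := by
    have : ({a + b + 5} : Finset ℕ).ssubsets = {∅} := by
      ext F; simp
    rwa [this, join_empty_left]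
  have hempty : ∅ ∈ boundaryJoin L := by
    have hne : (boundaryJoin L).Nonempty := by
      refine boundaryJoin_nonempty fun T hT => ?_
      have : T.card ∈ L.map Finset.card := List.mem_map_of_mem hT
      rw [hL] at this
      obtain ⟨m, -, hm⟩ := List.mem_map.1 this
      omega
    obtain ⟨F, hF⟩ := hne
    exact isComplex_boundaryJoin L (Finset.empty_subset F) hF
  have hle : ∀ i, {i} ∈ boundaryJoin L → i ≤ 4 := by
    intro i hi
    obtain ⟨S, hS, hiS⟩ := exists_mem_of_mem_verts_boundaryJoin
      ((isComplex_boundaryJoin L).mem_verts.2 hi)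
    exact hlist S hS i hiS
  refine ⟨h.ears.add_ball τ (by rw [hτ]; rfl) hL hd' hv hbd hcount hcount', fun i => ?_,
    fun i j hij => ?_⟩
  · rw [mem_union_ball hdis hbd, h.vertex, Finset.singleton_subset_iff, Finset.mem_singleton]
    constructor
    · rintro (h1 | ⟨rfl, -⟩) <;> omega
    · intro h1
      by_cases hi : i = a + b + 5
      · subst hi
        exact .inr ⟨rfl, by simpa using hempty⟩
      · omega
  · rw [mem_union_ball hdis hbd, h.edge i j hij, Finset.singleton_subset_iff, Finset.mem_insert,
      Finset.mem_singleton]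
    constructor
    · rintro (h1 | ⟨rfl | rfl, h2⟩)
      · omega
      · have : ({a + b + 5, j} : Finset ℕ) \ {a + b + 5} = {j} := by
          ext x
          simp only [Finset.mem_sdiff, Finset.mem_insert, Finset.mem_singleton]
          omega
        rw [this] at h2
        have := hle j h2
        omega
      · have : ({i, a + b + 5} : Finset ℕ) \ {a + b + 5} = {i} := by
          ext x
          simp only [Finset.mem_sdiff, Finset.mem_insert, Finset.mem_singleton]
          omega
        rw [this, hD] at h2
        omega
    · rintro ⟨h1, h2, h3⟩
      by_cases hj : j = a + b + 5
      · subst hj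
        have : ({i, a + b + 5} : Finset ℕ) \ {a + b + 5} = {i} := by
          ext x
          simp only [Finset.mem_sdiff, Finset.mem_insert, Finset.mem_singleton]
          omega
        rw [this, hD]
        exact .inr ⟨.inr rfl, h1, h2⟩
      · omega

/-- Because D i and D j are at least 2, the cycle v_1 v_i v_2 v_j is already present and an ear of
type E fits. The choice i = D j + 1 keeps the earlier neighbors of v_j an initial segment. -/
theorem IsCompressedComplex.add_edge {a b e f : ℕ} {D : ℕ → ℕ} {C : Finset (Finset ℕ)}
    (h : IsCompressedComplex a b e f D C) {i j : ℕ} (hij : i < j) (hi : i = D j + 1)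
    (hj : j ≤ a + b + 4) (hDi : 2 ≤ D i) (hDj : 2 ≤ D j) :
    IsCompressedComplex a b (e + 1) f (Function.update D j (D j + 1))
      (C ∪ join (Finset.powerset {i, j}) (boundaryJoin [{1, 2}])) := by
  have hd : ([{i, j}, {1, 2}] : List (Finset ℕ)).Pairwise Disjoint := by
    simp only [List.pairwise_cons, List.mem_singleton, forall_eq, List.not_mem_nil,
      List.Pairwise.nil, Finset.disjoint_left, Finset.mem_insert, Finset.mem_singleton]
    refine ⟨fun x => by omega, by simp, trivial⟩
  have hdis := disjoint_verts_boundaryJoin hd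
  have hC := h.ears.isPureComplex.1
  have hSC : {i, j} ∉ C := by
    rw [h.edge i j hij]
    omega
  have hbd : join (Finset.ssubsets {i, j}) (boundaryJoin [{1, 2}]) ⊆ C := by
    intro F hF
    obtain ⟨A, hA, B, hB, rfl⟩ := mem_join.1 hF
    obtain ⟨x, hx, hxA⟩ := Finset.exists_of_ssubset (Finset.mem_ssubsets.1 hA)
    rw [boundaryJoin_singleton] at hB
    obtain ⟨y, hy, hyB⟩ := Finset.exists_of_ssubset (Finset.mem_ssubsets.1 hB)
    have hA' := (Finset.mem_ssubsets.1 hA).1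
    have hB' := (Finset.mem_ssubsets.1 hB).1
    obtain ⟨u, hu, hAu⟩ : ∃ u, (u = i ∨ u = j) ∧ ∀ z ∈ A, z = u := by
      simp only [Finset.mem_insert, Finset.mem_singleton] at hx
      rcases hx with rfl | rfl
      · refine ⟨j, .inr rfl, fun z hz => ?_⟩
        have := hA' hz
        simp only [Finset.mem_insert, Finset.mem_singleton] at this
        exact this.resolve_left (by rintro rfl; exact hxA hz)
      · refine ⟨i, .inl rfl, fun z hz => ?_⟩
        have := hA' hz
        simp only [Finset.mem_insert, Finset.mem_singleton] at this
        exact this.resolve_right (by rintro rfl; exact hxA hz)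
    obtain ⟨w, hw, hBw⟩ : ∃ w, (w = 1 ∨ w = 2) ∧ ∀ z ∈ B, z = w := by
      simp only [Finset.mem_insert, Finset.mem_singleton] at hy
      rcases hy with rfl | rfl
      · refine ⟨2, .inr rfl, fun z hz => ?_⟩
        have := hB' hz
        simp only [Finset.mem_insert, Finset.mem_singleton] at this
        exact this.resolve_left (by rintro rfl; exact hyB hz)
      · refine ⟨1, .inl rfl, fun z hz => ?_⟩
        have := hB' hz
        simp only [Finset.mem_insert, Finset.mem_singleton] at this
        exact this.resolve_right (by rintro rfl; exact hyB hz)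
    -- A boundary face omits a vertex of each of the two pairs, so it lies in an edge from {1, 2} to
    -- {i, j}.
    refine hC (b := A ∪ B) (a := {w, u}) ?_ ?_
    · intro z hz
      rw [Finset.mem_insert, Finset.mem_singleton]
      rcases Finset.mem_union.1 hz with hz | hz
      exacts [.inr (hAu z hz), .inl (hBw z hz)]
    · refine (h.edge w u ?_).2 ?_
      · rcases hu with rfl | rfl <;> omega
      · rcases hu with rfl | rfl <;> omega
  refine ⟨h.ears.add_ball .E (Finset.card_pair hij.ne) (by simp [earDims]) hd hSC hbd rfl ?_,
    fun k => ?_, fun k l hkl => ?_⟩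
  · intro σ hσ
    cases σ <;> first | rfl | exact absurd rfl hσ
  · rw [mem_union_ball hdis hbd, h.vertex, or_iff_left]
    rintro ⟨h1, -⟩
    have hc := Finset.card_le_card h1
    rw [Finset.card_pair hij.ne, Finset.card_singleton] at hc
    omega
  · rw [mem_union_ball hdis hbd, h.edge k l hkl]
    constructor
    · rintro (h1 | ⟨h1, -⟩)
      · by_cases hl : l = j
        · subst hl
          rw [Function.update_self]
          omega
        · rwa [Function.update_of_ne hl]
      · have h2 := h1 (Finset.mem_insert_self _ _)
        have h3 := h1 (Finset.mem_insert_of_mem (Finset.mem_singleton_self _))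
        simp only [Finset.mem_insert, Finset.mem_singleton] at h2 h3
        obtain ⟨rfl, rfl⟩ : i = k ∧ j = l := by omega
        rw [Function.update_self]
        omega
    · intro h1
      by_cases hl : l = j
      · subst hl
        rw [Function.update_self] at h1
        by_cases hk : k ≤ D l
        · exact .inl ⟨h1.1, hk, h1.2.2⟩
        · obtain rfl : k = i := by omega
          refine .inr ⟨le_rfl, ?_⟩
          rw [Finset.sdiff_self]
          decide
      · rw [Function.update_of_ne hl] at h1
        exact .inl h1

/-- A missing triangle is an ear of type F; it brings no vertex or edge, so the profile is
unchanged. -/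
theorem IsCompressedComplex.add_triangle {a b e f : ℕ} {D : ℕ → ℕ} {C : Finset (Finset ℕ)}
    (h : IsCompressedComplex a b e f D C) {G : Finset ℕ} (hG : G.card = 3)
    (hm : IsMissingFace C G) : IsCompressedComplex a b e (f + 1) D (insert G C) := by
  have hbd : join G.ssubsets (boundaryJoin []) ⊆ C := by
    rw [boundaryJoin, join_empty_right]
    exact fun F hF => hm.2 F (Finset.mem_ssubsets.1 hF)
  have hins : insert G C = C ∪ join G.powerset (boundaryJoin []) := by
    rw [boundaryJoin, join_empty_right]
    ext F
    rw [Finset.mem_insert, Finset.mem_union, Finset.mem_powerset]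
    constructor
    · rintro (rfl | hF)
      exacts [.inr le_rfl, .inl hF]
    · rintro (hF | hF)
      · exact .inr hF
      · rcases hF.eq_or_ssubset with hF | hF
        exacts [.inl hF, .inr (hm.2 F hF)]
  refine ⟨?_, fun i => ?_, fun i j hij => ?_⟩
  · rw [hins]
    refine h.ears.add_ball .F hG rfl (by simp) hm.1 hbd rfl ?_
    intro σ hσ
    cases σ <;> first | rfl | exact absurd rfl hσ
  · rw [Finset.mem_insert, h.vertex, or_iff_right]
    rintro rfl
    simp at hG
  · rw [Finset.mem_insert, h.edge i j hij, or_iff_right]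
    rintro rfl
    rw [Finset.card_pair hij.ne] at hG
    omega

end CompressedComplex

/-! ### The multicomplex built by the algorithm -/

section CompressedMonomials

/-- The number of monomials of degree `k` in `M`. -/
def degNum (M : Finset (Multiset ℕ)) (k : ℕ) : ℕ :=
  (M.filter fun μ => Multiset.card μ = k).card

theorem degNum_union {M N : Finset (Multiset ℕ)} (h : Disjoint M N) (k : ℕ) :
    degNum (M ∪ N) k = degNum M k + degNum N k := by
  unfold degNum
  rw [Finset.filter_union, Finset.card_union_of_disjoint]
  exact h.mono (Finset.filter_subset _ _) (Finset.filter_subset _ _)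

theorem isLowerSet_of_erase {M : Finset (Multiset ℕ)} (h : ∀ μ ∈ M, ∀ x ∈ μ, μ.erase x ∈ M) :
    IsLowerSet (M : Set (Multiset ℕ)) := by
  intro μ ν hνμ hμ
  rw [Finset.mem_coe] at hμ ⊢
  induction μ using Multiset.strongInductionOn with
  | ih μ ih =>
    rcases hνμ.eq_or_lt with rfl | hlt
    · exact hμ
    · obtain ⟨x, hx⟩ := Multiset.lt_iff_cons_le.1 hlt
      have hxμ : x ∈ μ := Multiset.mem_of_le hx (Multiset.mem_cons_self x ν)
      have := Multiset.erase_le_erase x hx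
      rw [Multiset.erase_cons_head] at this
      exact ih _ (Multiset.erase_lt.2 hxμ) this (h μ hμ x hxμ)

theorem pair_eq_pair_iff {i j k l : ℕ} (hkl : k ≤ l) (hij : i ≤ j) :
    ({k, l} : Multiset ℕ) = {i, j} ↔ k = i ∧ l = j := by
  refine ⟨fun h => ?_, by rintro ⟨rfl, rfl⟩; rfl⟩
  have h1 : k ∈ ({i, j} : Multiset ℕ) := by rw [← h]; simp
  have h2 : l ∈ ({i, j} : Multiset ℕ) := by rw [← h]; simp
  have h3 : i ∈ ({k, l} : Multiset ℕ) := by rw [h]; simp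
  have h4 : j ∈ ({k, l} : Multiset ℕ) := by rw [h]; simp
  simp only [Multiset.insert_eq_cons, Multiset.mem_cons, Multiset.mem_singleton] at h1 h2 h3 h4
  omega

theorem pair_ne_zero (k l : ℕ) : ({k, l} : Multiset ℕ) ≠ 0 := Multiset.cons_ne_zero

theorem pair_ne_singleton (k l i : ℕ) : ({k, l} : Multiset ℕ) ≠ {i} := fun h => by
  simpa using congrArg Multiset.card h

theorem pair_ne_triple (k l x y z : ℕ) : ({k, l} : Multiset ℕ) ≠ {x, y, z} := fun h => by
  simpa using congrArg Multiset.card h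

theorem singleton_ne_pair (i k l : ℕ) : ({i} : Multiset ℕ) ≠ {k, l} :=
  (pair_ne_singleton k l i).symm

theorem singleton_ne_triple (i x y z : ℕ) : ({i} : Multiset ℕ) ≠ {x, y, z} := fun h => by
  simpa using congrArg Multiset.card h

/-- A multicomplex with `1 + a + b`, `1 + a + 2b + e` and `1 + a + b + e + f` monomials of degrees
`1`, `2` and `3`, each dividing one of degree `3`, whose monomials of degree two correspond to the
edges of a compressed complex. -/
structure IsCompressedMonomials (a b e f : ℕ) (D : ℕ → ℕ) (M : Finset (Multiset ℕ)) : Prop where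
  erase : ∀ μ ∈ M, ∀ x ∈ μ, μ.erase x ∈ M
  extend : ∀ μ ∈ M, ∃ ν ∈ M, μ ≤ ν ∧ Multiset.card ν = 3
  single : ∀ i, {i} ∈ M ↔ 4 ≤ i ∧ i ≤ a + b + 4
  pair : ∀ i j, i ≤ j → ({i, j} ∈ M ↔ 4 ≤ i ∧ j ≤ a + b + 4 ∧ (i = j ∨ i ≤ D j))
  deg_zero : degNum M 0 = 1
  deg_one : degNum M 1 = 1 + a + b
  deg_two : degNum M 2 = 1 + a + 2 * b + e
  deg_three : degNum M 3 = 1 + a + b + e + f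

theorem IsCompressedMonomials.base (D : ℕ → ℕ) :
    IsCompressedMonomials 0 0 0 0 D {0, {4}, {4, 4}, {4, 4, 4}} := by
  refine ⟨by decide, by decide, fun i => ?_, fun i j hij => ?_, by decide, by decide, by decide,
    by decide⟩
  · simp only [Finset.mem_insert, Finset.mem_singleton, Multiset.singleton_inj, singleton_ne_pair,
      singleton_ne_triple, Multiset.singleton_ne_zero, false_or, or_false]
    omega
  · simp only [Finset.mem_insert, Finset.mem_singleton, pair_ne_zero, pair_ne_singleton,
      pair_ne_triple, false_or, or_false, pair_eq_pair_iff hij le_rfl]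
    omega

/-- All new monomials are multiples of one absent monomial, so a divisor-closed `M` contains none of
them and the degree counts add. -/
theorem disjoint_of_forall_le {M N : Finset (Multiset ℕ)} {ξ : Multiset ℕ}
    (h : ∀ μ ∈ M, ∀ x ∈ μ, μ.erase x ∈ M) (hξ : ξ ∉ M) (hN : ∀ μ ∈ N, ξ ≤ μ) : Disjoint M N :=
  Finset.disjoint_left.2 fun μ hμ hμN => hξ (isLowerSet_of_erase h (hN μ hμN) hμ)

/-- Four earlier neighbors include v_4 as the only vertex with a variable, whence x_4 x_{b+5} is the
one new quadratic besides the square. Every new monomial divides x_4 x_{b+5}^2. -/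
theorem IsCompressedMonomials.cone_B {b : ℕ} {D : ℕ → ℕ} {M : Finset (Multiset ℕ)}
    (h : IsCompressedMonomials 0 b 0 0 D M) (hD : D (b + 5) = 4) :
    IsCompressedMonomials 0 (b + 1) 0 0 D
      (M ∪ {{b + 5}, {4, b + 5}, {b + 5, b + 5}, {4, b + 5, b + 5}}) := by
  have h0 : (0 : Multiset ℕ) ∈ M := by
    have := h.erase {4} ((h.single 4).2 ⟨le_rfl, by omega⟩) 4 (by simp)
    simpa using this
  have h4 : ({4} : Multiset ℕ) ∈ M := (h.single 4).2 ⟨le_rfl, by omega⟩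
  have hd : Disjoint M {{b + 5}, {4, b + 5}, {b + 5, b + 5}, {4, b + 5, b + 5}} := by
    refine disjoint_of_forall_le h.erase (ξ := {b + 5}) ?_ ?_
    · rw [h.single]; omega
    · simp
  refine ⟨?_, ?_, fun i => ?_, fun i j hij => ?_, ?_, ?_, ?_, ?_⟩
  · intro μ hμ x hx
    rcases Finset.mem_union.1 hμ with hμ | hμ
    · exact Finset.mem_union_left _ (h.erase μ hμ x hx)
    · simp only [Finset.mem_insert, Finset.mem_singleton] at hμ
      rcases hμ with rfl | rfl | rfl | rfl
      · obtain rfl : x = b + 5 := by simpa using hx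
        simp [h0]
      · obtain rfl | rfl : x = 4 ∨ x = b + 5 := by simpa using hx
        · simp
        · simp [Multiset.erase_cons_tail, h4]
      · obtain rfl : x = b + 5 := by simpa using hx
        simp
      · obtain rfl | rfl : x = 4 ∨ x = b + 5 := by simpa using hx
        · simp
        · simp [Multiset.erase_cons_tail]
  · intro μ hμ
    rcases Finset.mem_union.1 hμ with hμ | hμ
    · obtain ⟨ν, hν, h1⟩ := h.extend μ hμ
      exact ⟨ν, Finset.mem_union_left _ hν, h1⟩
    · refine ⟨{4, b + 5, b + 5}, by simp, ?_, by simp⟩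
      simp only [Finset.mem_insert, Finset.mem_singleton] at hμ
      rcases hμ with rfl | rfl | rfl | rfl
      · simp
      · exact Multiset.cons_le_cons _ (by simp)
      · exact Multiset.le_cons_self _ _
      · exact le_rfl
  · simp only [Finset.mem_union, h.single, Finset.mem_insert, Finset.mem_singleton,
      Multiset.singleton_inj, singleton_ne_pair, singleton_ne_triple, or_false]
    omega
  · simp only [Finset.mem_union, h.pair i j hij, Finset.mem_insert, Finset.mem_singleton,
      pair_ne_singleton, pair_ne_triple, false_or, or_false, pair_eq_pair_iff hij le_rfl,
      pair_eq_pair_iff hij (show 4 ≤ b + 5 by omega)]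
    constructor
    · rintro (h1 | ⟨rfl, rfl⟩ | ⟨rfl, rfl⟩) <;> omega
    · intro h1
      by_cases hj : j = b + 5
      · subst hj
        omega
      · omega
  · rw [degNum_union hd, h.deg_zero]
    simp [degNum, Finset.filter_insert, Finset.filter_singleton]
  · rw [degNum_union hd, h.deg_one]
    simp [degNum, Finset.filter_insert, Finset.filter_singleton]
    omega
  · rw [degNum_union hd, h.deg_two]
    simp [degNum, Finset.filter_insert, Finset.filter_singleton]
    omega
  · rw [degNum_union hd, h.deg_three]
    simp [degNum, Finset.filter_insert, Finset.filter_singleton]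
    omega

/-- Three earlier neighbors stop short of v_4, so the only new quadratic is the square, and all new
monomials divide the cube. -/
theorem IsCompressedMonomials.cone_A {a b : ℕ} {D : ℕ → ℕ} {M : Finset (Multiset ℕ)}
    (h : IsCompressedMonomials a b 0 0 D M) (hD : D (a + b + 5) = 3) :
    IsCompressedMonomials (a + 1) b 0 0 D
      (M ∪ {{a + b + 5}, {a + b + 5, a + b + 5}, {a + b + 5, a + b + 5, a + b + 5}}) := by
  have h0 : (0 : Multiset ℕ) ∈ M := by
    have := h.erase {4} ((h.single 4).2 ⟨le_rfl, by omega⟩) 4 (by simp)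
    simpa using this
  have hd : Disjoint M
      {{a + b + 5}, {a + b + 5, a + b + 5}, {a + b + 5, a + b + 5, a + b + 5}} := by
    refine disjoint_of_forall_le h.erase (ξ := {a + b + 5}) ?_ ?_
    · rw [h.single]; omega
    · simp
  refine ⟨?_, ?_, fun i => ?_, fun i j hij => ?_, ?_, ?_, ?_, ?_⟩
  · intro μ hμ x hx
    rcases Finset.mem_union.1 hμ with hμ | hμ
    · exact Finset.mem_union_left _ (h.erase μ hμ x hx)
    · simp only [Finset.mem_insert, Finset.mem_singleton] at hμ
      rcases hμ with rfl | rfl | rfl <;>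
      · obtain rfl : x = a + b + 5 := by simpa using hx
        simp [h0]
  · intro μ hμ
    rcases Finset.mem_union.1 hμ with hμ | hμ
    · obtain ⟨ν, hν, h1⟩ := h.extend μ hμ
      exact ⟨ν, Finset.mem_union_left _ hν, h1⟩
    · refine ⟨{a + b + 5, a + b + 5, a + b + 5}, by simp, ?_, by simp⟩
      simp only [Finset.mem_insert, Finset.mem_singleton] at hμ
      rcases hμ with rfl | rfl | rfl
      · simp
      · exact Multiset.le_cons_self _ _
      · exact le_rfl
  · simp only [Finset.mem_union, h.single, Finset.mem_insert, Finset.mem_singleton,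
      Multiset.singleton_inj, singleton_ne_pair, singleton_ne_triple, or_false]
    omega
  · simp only [Finset.mem_union, h.pair i j hij, Finset.mem_insert, Finset.mem_singleton,
      pair_ne_singleton, pair_ne_triple, false_or, or_false, pair_eq_pair_iff hij le_rfl]
    constructor
    · rintro (h1 | ⟨rfl, rfl⟩) <;> omega
    · intro h1
      by_cases hj : j = a + b + 5
      · subst hj
        omega
      · omega
  · rw [degNum_union hd, h.deg_zero]
    simp [degNum, Finset.filter_insert, Finset.filter_singleton]
  · rw [degNum_union hd, h.deg_one]
    simp [degNum, Finset.filter_insert, Finset.filter_singleton]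
    omega
  · rw [degNum_union hd, h.deg_two]
    simp [degNum, Finset.filter_insert, Finset.filter_singleton]
    omega
  · rw [degNum_union hd, h.deg_three]
    simp [degNum, Finset.filter_insert, Finset.filter_singleton]
    omega

/-- Since x_i^2 is already present, adding x_i^2 x_j keeps closure under divisors and gives x_i x_j
a cubic multiple. -/
theorem IsCompressedMonomials.add_edge {a b e f : ℕ} {D : ℕ → ℕ} {M : Finset (Multiset ℕ)}
    (h : IsCompressedMonomials a b e f D M) {i j : ℕ} (hij : i < j) (hi : i = D j + 1)
    (h4 : 4 ≤ i) (hj : j ≤ a + b + 4) :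
    IsCompressedMonomials a b (e + 1) f (Function.update D j (D j + 1))
      (M ∪ {{i, j}, {i, i, j}}) := by
  have hii : ({i, i} : Multiset ℕ) ∈ M := (h.pair i i le_rfl).2 ⟨h4, by omega, .inl rfl⟩
  have hi' : ({i} : Multiset ℕ) ∈ M := (h.single i).2 ⟨h4, by omega⟩
  have hj' : ({j} : Multiset ℕ) ∈ M := (h.single j).2 ⟨by omega, by omega⟩
  have hd : Disjoint M {{i, j}, {i, i, j}} := by
    refine disjoint_of_forall_le h.erase (ξ := {i, j}) ?_ ?_
    · rw [h.pair i j hij.le]; omega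
    · simp only [Finset.mem_insert, Finset.mem_singleton, forall_eq_or_imp, forall_eq, le_refl,
        true_and]
      exact Multiset.le_cons_self _ _
  refine ⟨?_, ?_, fun k => ?_, fun k l hkl => ?_, ?_, ?_, ?_, ?_⟩
  · intro μ hμ x hx
    rcases Finset.mem_union.1 hμ with hμ | hμ
    · exact Finset.mem_union_left _ (h.erase μ hμ x hx)
    · simp only [Finset.mem_insert, Finset.mem_singleton] at hμ
      rcases hμ with rfl | rfl
      · obtain rfl | rfl : x = i ∨ x = j := by simpa using hx
        · simp [hj']
        · simp [Multiset.erase_cons_tail, hij.ne, hi']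
      · obtain rfl | rfl : x = i ∨ x = j := by simpa using hx
        · simp
        · rw [Finset.mem_union]
          left
          simpa [Multiset.erase_cons_tail, hij.ne] using hii
  · intro μ hμ
    rcases Finset.mem_union.1 hμ with hμ | hμ
    · obtain ⟨ν, hν, h1⟩ := h.extend μ hμ
      exact ⟨ν, Finset.mem_union_left _ hν, h1⟩
    · refine ⟨{i, i, j}, by simp, ?_, by simp⟩
      simp only [Finset.mem_insert, Finset.mem_singleton] at hμ
      rcases hμ with rfl | rfl
      · exact Multiset.le_cons_self _ _
      · exact le_rfl
  · simp only [Finset.mem_union, h.single, Finset.mem_insert, Finset.mem_singleton,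
      singleton_ne_pair, singleton_ne_triple, or_false]
  · simp only [Finset.mem_union, h.pair k l hkl, Finset.mem_insert, Finset.mem_singleton,
      pair_ne_triple, or_false, pair_eq_pair_iff hkl hij.le]
    by_cases hl : l = j
    · subst hl
      rw [Function.update_self]
      omega
    · rw [Function.update_of_ne hl]
      omega
  · rw [degNum_union hd, h.deg_zero]
    simp [degNum, Finset.filter_insert, Finset.filter_singleton]
  · rw [degNum_union hd, h.deg_one]
    simp [degNum, Finset.filter_insert, Finset.filter_singleton]
  · rw [degNum_union hd, h.deg_two]
    simp [degNum, Finset.filter_insert, Finset.filter_singleton]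
    omega
  · rw [degNum_union hd, h.deg_three]
    simp [degNum, Finset.filter_insert, Finset.filter_singleton]
    omega

theorem IsCompressedMonomials.add_cubic {a b e f : ℕ} {D : ℕ → ℕ} {M : Finset (Multiset ℕ)}
    (h : IsCompressedMonomials a b e f D M) {μ : Multiset ℕ} (hμ : Multiset.card μ = 3)
    (ha : IsAvailable M μ) : IsCompressedMonomials a b e (f + 1) D (insert μ M) := by
  have hd : Disjoint {μ} M := Finset.disjoint_singleton_left.2 ha.1
  have hdeg : ∀ k, degNum (insert μ M) k = degNum M k + if k = 3 then 1 else 0 := by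
    intro k
    rw [Finset.insert_eq, degNum_union hd, add_comm]
    congr 1
    rw [degNum, Finset.filter_singleton, hμ]
    by_cases hk : k = 3
    · simp [hk]
    · simp [hk, Ne.symm hk]
  refine ⟨?_, ?_, fun k => ?_, fun k l hkl => ?_, ?_, ?_, ?_, ?_⟩
  · intro ν hν x hx
    refine Finset.mem_insert_of_mem ?_
    rcases Finset.mem_insert.1 hν with rfl | hν
    · exact ha.2 _ (Multiset.erase_lt.2 hx)
    · exact h.erase ν hν x hx
  · intro ν hν
    rcases Finset.mem_insert.1 hν with rfl | hν
    · exact ⟨ν, by simp, le_rfl, hμ⟩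
    · obtain ⟨ξ, hξ, h1⟩ := h.extend ν hν
      exact ⟨ξ, Finset.mem_insert_of_mem hξ, h1⟩
  · rw [Finset.mem_insert, h.single, or_iff_right]
    rintro rfl
    simp at hμ
  · rw [Finset.mem_insert, h.pair k l hkl, or_iff_right]
    rintro rfl
    simp at hμ
  · rw [hdeg, h.deg_zero]; simp
  · rw [hdeg, h.deg_one]; simp
  · rw [hdeg, h.deg_two]; simp
  · rw [hdeg, h.deg_three]; simp; omega

theorem IsCompressedMonomials.isPureMulticomplex {a b e f : ℕ} {D : ℕ → ℕ}
    {M : Finset (Multiset ℕ)} (h : IsCompressedMonomials a b e f D M) : IsPureMulticomplex M := by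
  refine ⟨⟨⟨{4}, (h.single 4).2 ⟨le_rfl, by omega⟩⟩, isLowerSet_of_erase h.erase⟩, 3,
    fun μ hμ => ?_⟩
  obtain ⟨ν, hν, hle, h3⟩ := h.extend μ hμ.prop
  rw [← h3, hμ.eq_of_le hν hle]

theorem IsCompressedMonomials.fVector {a b e f : ℕ} {D : ℕ → ℕ}
    {M : Finset (Multiset ℕ)} (h : IsCompressedMonomials a b e f D M) :
    FVector M = [1, ((1 + a + b : ℕ) : ℤ), ((1 + a + 2 * b + e : ℕ) : ℤ),
      ((1 + a + b + e + f : ℕ) : ℤ)] := by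
  have hsup : M.sup Multiset.card = 3 := by
    refine le_antisymm (Finset.sup_le fun μ hμ => ?_) ?_
    · obtain ⟨ν, hν, hle, h3⟩ := h.extend μ hμ
      rw [← h3]
      exact Multiset.card_le_card hle
    · obtain ⟨ν, hν, -, h3⟩ := h.extend {4} ((h.single 4).2 ⟨le_rfl, by omega⟩)
      rw [← h3]
      exact Finset.le_sup (f := Multiset.card) hν
  have d0 := h.deg_zero
  have d1 := h.deg_one
  have d2 := h.deg_two
  have d3 := h.deg_three
  unfold degNum at d0 d1 d2 d3
  rw [FVector, hsup]
  simp only [List.range_succ, List.range_zero, List.nil_append, List.cons_append, List.map_cons,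
    List.map_nil, d0, d1, d2, d3]
  simp

end CompressedMonomials

/-! ### Missing triangles and available cubics exist -/

section Existence

theorem IsCompressedComplex.isMissingFace_pair_iff {a b e f : ℕ} {D : ℕ → ℕ}
    {C : Finset (Finset ℕ)} (h : IsCompressedComplex a b e f D C) {i j : ℕ} (hij : i < j) :
    IsMissingFace C {i, j} ↔ 1 ≤ i ∧ D j < i ∧ j ≤ a + b + 4 := by
  have hC := h.ears.isPureComplex.1
  constructor
  · rintro ⟨h1, h2⟩
    rw [h.edge i j hij] at h1
    have hi := h2 {i} (by
      refine Finset.ssubset_iff_subset_ne.2 ⟨by simp, fun hc => ?_⟩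
      have := congrArg Finset.card hc
      rw [Finset.card_pair hij.ne] at this
      simp at this)
    have hj := h2 {j} (by
      refine Finset.ssubset_iff_subset_ne.2 ⟨by simp, fun hc => ?_⟩
      have := congrArg Finset.card hc
      rw [Finset.card_pair hij.ne] at this
      simp at this)
    rw [h.vertex] at hi hj
    omega
  · intro h1
    refine ⟨?_, fun H hH => ?_⟩
    · rw [h.edge i j hij]
      omega
    · obtain ⟨x, hx, hxH⟩ := Finset.exists_of_ssubset hH
      simp only [Finset.mem_insert, Finset.mem_singleton] at hx
      rcases hx with rfl | rfl
      · refine hC (b := H) (a := {j}) (fun z hz => ?_) ((h.vertex j).2 (by omega))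
        have := hH.1 hz
        simp only [Finset.mem_insert, Finset.mem_singleton] at this ⊢
        exact this.resolve_left (by rintro rfl; exact hxH hz)
      · refine hC (b := H) (a := {i}) (fun z hz => ?_) ((h.vertex i).2 (by omega))
        have := hH.1 hz
        simp only [Finset.mem_insert, Finset.mem_singleton] at this ⊢
        exact this.resolve_right (by rintro rfl; exact hxH hz)

/-- If there are no missing triangles, then every triangle of the graph is a face. -/
theorem mem_of_no_missing_triangle {C : Finset (Finset ℕ)} (hC : IsComplex C)
    (hm : ∀ G : Finset ℕ, G.card = 3 → ¬ IsMissingFace C G) {x y z : ℕ} (hxy : x < y) (hyz : y < z)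
    (h1 : {x, y} ∈ C) (h2 : {x, z} ∈ C) (h3 : {y, z} ∈ C) : {z, x, y} ∈ C := by
  by_contra hc
  refine hm {z, x, y} (Finset.card_eq_three.2 ⟨z, x, y, by omega, by omega, by omega, rfl⟩)
    ⟨hc, fun H hH => ?_⟩
  obtain ⟨u, hu, huH⟩ := Finset.exists_of_ssubset hH
  have hsub : H ⊆ ({z, x, y} : Finset ℕ).erase u := Finset.subset_erase.2 ⟨hH.1, huH⟩
  refine hC hsub ?_
  simp only [Finset.mem_insert, Finset.mem_singleton] at hu
  rw [Finset.mem_coe]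
  rcases hu with rfl | rfl | rfl
  · convert h1 using 1
    ext w
    simp only [Finset.mem_erase, Finset.mem_insert, Finset.mem_singleton]
    omega
  · convert h3 using 1
    ext w
    simp only [Finset.mem_erase, Finset.mem_insert, Finset.mem_singleton]
    omega
  · convert h2 using 1
    ext w
    simp only [Finset.mem_erase, Finset.mem_insert, Finset.mem_singleton]
    omega

/-- By `initial_clique`, v_j and any two of v_1, ..., v_{D j} span a triangle of the graph. If none
were missing, all would be faces; j is recovered as the largest index, so there would be at least
the sum of C(D j, 2) triangular faces. -/
theorem IsCompressedComplex.exists_missing_triangle {a b e f p : ℕ} {D : ℕ → ℕ}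
    {C : Finset (Finset ℕ)} (h : IsCompressedComplex a b e f D C) (hD : Profile a b e D p)
    (hlt : fNum C 3 < ∑ j ∈ Finset.range (a + b + 5), (D j).choose 2) :
    ∃ G : Finset ℕ, G.card = 3 ∧ IsMissingFace C G := by
  by_contra! hm
  have hC := h.ears.isPureComplex.1
  have hlast : ∀ (j : ℕ) (q : Finset ℕ), q ∈ (Finset.Icc 1 (D j)).powersetCard 2 →
      ∀ x ∈ q, x < j := by
    intro j q hq x hx
    have := Finset.mem_Icc.1 ((Finset.mem_powersetCard.1 hq).1 hx)
    have := hD.le_pred j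
    omega
  refine absurd hlt (not_lt.2 ?_)
  have hcard : ∑ j ∈ Finset.range (a + b + 5), (D j).choose 2 =
      ((Finset.range (a + b + 5)).sigma fun j => (Finset.Icc 1 (D j)).powersetCard 2).card := by
    rw [Finset.card_sigma]
    simp
  rw [hcard]
  refine Finset.card_le_card_of_injOn (fun q => insert q.1 q.2) ?_ ?_
  · rintro ⟨j, q⟩ hq
    rw [Finset.mem_coe, Finset.mem_sigma] at hq
    obtain ⟨hj, hq⟩ := hq
    simp only [Finset.mem_range] at hj hq
    have hjq : j ∉ q := fun hc => (hlast j q hq j hc).false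
    rw [Finset.mem_coe, Finset.mem_filter]
    refine ⟨?_, by rw [Finset.card_insert_of_notMem hjq, (Finset.mem_powersetCard.1 hq).2]⟩
    obtain ⟨x, y, hxy, rfl⟩ : ∃ x y, x < y ∧ q = {x, y} := by
      obtain ⟨x, y, hne, rfl⟩ := Finset.card_eq_two.1 (Finset.mem_powersetCard.1 hq).2
      rcases hne.lt_or_gt with hlt | hlt
      · exact ⟨x, y, hlt, rfl⟩
      · exact ⟨y, x, hlt, Finset.pair_comm x y⟩
    have hx := Finset.mem_Icc.1 ((Finset.mem_powersetCard.1 hq).1 (by simp : x ∈ {x, y}))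
    have hy := Finset.mem_Icc.1 ((Finset.mem_powersetCard.1 hq).1 (by simp : y ∈ {x, y}))
    have hyj := hlast j _ hq y (by simp)
    exact mem_of_no_missing_triangle hC hm hxy hyj
      ((h.edge x y hxy).2 ⟨hx.1, hD.initial_clique hxy hy.2, by omega⟩)
      ((h.edge x j (by omega)).2 ⟨hx.1, hx.2, by omega⟩)
      ((h.edge y j hyj).2 ⟨hy.1, hy.2, by omega⟩)
  · rintro ⟨j, q⟩ hq ⟨j', q'⟩ hq' he
    rw [Finset.mem_coe, Finset.mem_sigma] at hq hq'
    have hq := hlast j q hq.2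
    have hq' := hlast j' q' hq'.2
    simp only at he
    have h1 : j ∈ insert j' q' := by rw [← he]; simp
    have h2 : j' ∈ insert j q := by rw [he]; simp
    obtain rfl : j = j' := by
      rcases Finset.mem_insert.1 h1 with h1 | h1
      · exact h1
      · rcases Finset.mem_insert.1 h2 with h2 | h2
        · exact h2.symm
        · have := hq _ h2
          have := hq' _ h1
          omega
    have hj : j ∉ q := fun hc => (hq j hc).false
    have hj' : j ∉ q' := fun hc => (hq' j hc).false
    rw [← Finset.erase_insert hj, he, Finset.erase_insert hj']

theorem exists_le_of_sym2 (z : Sym2 ℕ) : ∃ x y, x ≤ y ∧ z = s(x, y) := by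
  induction z with
  | _ x y =>
    rcases le_total x y with h | h
    exacts [⟨x, y, h, rfl⟩, ⟨y, x, h, Sym2.eq_swap⟩]

/-- If no cubic monomial is available, then every cubic monomial whose quadratic divisors are
present is present. -/
theorem mem_of_no_available_cubic {M : Finset (Multiset ℕ)} (hM : IsLowerSet (M : Set (Multiset ℕ)))
    (hm : ∀ μ : Multiset ℕ, Multiset.card μ = 3 → ¬ IsAvailable M μ) {x y z : ℕ}
    (h1 : {x, y} ∈ M) (h2 : {x, z} ∈ M) (h3 : {y, z} ∈ M) : z ::ₘ {x, y} ∈ M := by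
  by_contra hc
  refine hm _ (by simp) ⟨hc, fun ν hν => ?_⟩
  obtain ⟨u, hu⟩ := Multiset.lt_iff_cons_le.1 hν
  have hmem := Multiset.mem_of_le hu (Multiset.mem_cons_self u ν)
  have hle := Multiset.erase_le_erase u hu
  rw [Multiset.erase_cons_head] at hle
  refine hM hle ?_
  rw [Finset.mem_coe]
  have e1 : z ::ₘ {x, y} = y ::ₘ ({x, z} : Multiset ℕ) := by
    rw [Multiset.pair_comm x z]
    change z ::ₘ x ::ₘ {y} = y ::ₘ z ::ₘ {x}
    rw [Multiset.cons_swap y z]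
    exact congrArg _ (Multiset.pair_comm x y)
  have e2 : z ::ₘ {x, y} = x ::ₘ ({y, z} : Multiset ℕ) := by
    rw [Multiset.pair_comm y z]
    exact Multiset.cons_swap z x {y}
  obtain rfl | rfl | rfl : u = z ∨ u = x ∨ u = y := by simpa using hmem
  · rwa [Multiset.erase_cons_head]
  · rwa [e2, Multiset.erase_cons_head]
  · rwa [e1, Multiset.erase_cons_head]

/-- Fix the largest variable x_j with j = 4 + i. The other two factors may be chosen with repetition
from x_j and x_4, ..., x_{D j}; these are D j - 2 variables, hence C(D j - 1, 2) cubics. All their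
quadratic divisors are present, and the counting argument for triangles applies. -/
theorem IsCompressedMonomials.exists_available {a b e f p : ℕ} {D : ℕ → ℕ}
    {M : Finset (Multiset ℕ)} (h : IsCompressedMonomials a b e f D M) (hD : Profile a b e D p)
    (hlt : degNum M 3 < ∑ i ∈ Finset.range (a + b + 1), (D (4 + i) - 1).choose 2) :
    ∃ μ : Multiset ℕ, Multiset.card μ = 3 ∧ IsAvailable M μ := by
  by_contra! hm
  have hlast : ∀ (i : ℕ) (z : Sym2 ℕ), z ∈ (insert (4 + i) (Finset.Icc 4 (D (4 + i)))).sym2 →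
      ∀ x ∈ z, 4 ≤ x ∧ x ≤ 4 + i ∧ (x = 4 + i ∨ x ≤ D (4 + i)) := by
    intro i z hz x hx
    have h1 := Finset.mem_sym2_iff.1 hz x hx
    rw [Finset.mem_insert, Finset.mem_Icc] at h1
    have := hD.le_pred (4 + i)
    omega
  refine absurd hlt (not_lt.2 ?_)
  have hcard : ∑ i ∈ Finset.range (a + b + 1), (D (4 + i) - 1).choose 2 =
      ((Finset.range (a + b + 1)).sigma fun i =>
        (insert (4 + i) (Finset.Icc 4 (D (4 + i)))).sym2).card := by
    rw [Finset.card_sigma]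
    refine Finset.sum_congr rfl fun i _ => ?_
    have h3 := hD.three_le (show 4 ≤ 4 + i by omega)
    have h4 := hD.le_pred (4 + i)
    rw [Finset.card_sym2, Finset.card_insert_of_notMem, Nat.card_Icc]
    · congr 1
      omega
    · rw [Finset.mem_Icc]
      omega
  rw [hcard]
  refine Finset.card_le_card_of_injOn (fun q => (4 + q.1) ::ₘ q.2.toMultiset) ?_ ?_
  · rintro ⟨i, z⟩ hz
    rw [Finset.mem_coe, Finset.mem_sigma] at hz
    obtain ⟨hi, hz⟩ := hz
    simp only [Finset.mem_range] at hi hz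
    rw [Finset.mem_coe, Finset.mem_filter]
    refine ⟨?_, by simp [Sym2.card_toMultiset]⟩
    obtain ⟨x, y, hxy, rfl⟩ := exists_le_of_sym2 z
    have hx := hlast i _ hz x (by simp)
    have hy := hlast i _ hz y (by simp)
    change (4 + i) ::ₘ ({x, y} : Multiset ℕ) ∈ M
    refine mem_of_no_available_cubic (isLowerSet_of_erase h.erase) hm ?_ ?_ ?_
    · rw [h.pair x y hxy]
      refine ⟨hx.1, by omega, ?_⟩
      rcases hxy.eq_or_lt with hxy | hxy
      · exact .inl hxy
      · rcases hy.2.2 with rfl | hy2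
        · omega
        · exact .inr (hD.initial_clique hxy hy2)
    · rw [h.pair x _ hx.2.1]
      omega
    · rw [h.pair y _ hy.2.1]
      omega
  · rintro ⟨i, z⟩ hz ⟨i', z'⟩ hz' he
    rw [Finset.mem_coe, Finset.mem_sigma] at hz hz'
    have hz := hlast i z hz.2
    have hz' := hlast i' z' hz'.2
    simp only at he
    have h1 : 4 + i ∈ (4 + i') ::ₘ z'.toMultiset := by rw [← he]; simp
    have h2 : 4 + i' ∈ (4 + i) ::ₘ z.toMultiset := by rw [he]; simp
    rw [Multiset.mem_cons, Sym2.mem_toMultiset] at h1 h2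
    obtain rfl : i = i' := by
      rcases h1 with h1 | h1
      · omega
      · rcases h2 with h2 | h2
        · omega
        · have := hz _ h2
          have := hz' _ h1
          omega
    have h3 := (Multiset.cons_inj_right _).1 he
    have h4 : z = z' := Sym2.ext fun x => by
      rw [← Sym2.mem_toMultiset, ← Sym2.mem_toMultiset, h3]
    rw [h4]

/-- Use C(D,2) = C(D-1,2) + (D-1) for j ≥ 4 and the edge count; v_3 contributes the remaining
triangle. The constant 3+2a+3b+e is the difference between the numbers 4+3a+4b+2e+f of triangular
faces and 1+a+b+e+f of cubics, for every f. -/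
theorem Profile.sum_choose_eq {a b e p : ℕ} {D : ℕ → ℕ} (h : Profile a b e D p) :
    ∑ j ∈ Finset.range (a + b + 5), (D j).choose 2 =
      (∑ i ∈ Finset.range (a + b + 1), (D (4 + i) - 1).choose 2) + (3 + 2 * a + 3 * b + e) := by
  have h4 := h.four_le
  have d0 : D 0 = 0 := h.below 0 (by omega)
  have d1 : D 1 = 0 := h.below 1 (by omega)
  have d2 : D 2 = 1 := h.below 2 (by omega)
  have d3 : D 3 = 2 := h.below 3 (by omega)
  have hs := h.sum
  rw [show a + b + 5 = 4 + (a + b + 1) by ring, Finset.sum_range_add] at hs ⊢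
  simp only [Finset.sum_range_succ _ 3, Finset.sum_range_succ _ 2, Finset.sum_range_succ _ 1,
    Finset.sum_range_one, d0, d1, d2, d3] at hs ⊢
  have key : ∑ i ∈ Finset.range (a + b + 1), (D (4 + i)).choose 2 + (a + b + 1) =
      ∑ i ∈ Finset.range (a + b + 1), (D (4 + i) - 1).choose 2 +
        ∑ i ∈ Finset.range (a + b + 1), D (4 + i) := by
    have hc : a + b + 1 = ∑ i ∈ Finset.range (a + b + 1), 1 := by simp
    nth_rw 2 [hc]
    rw [← Finset.sum_add_distrib, ← Finset.sum_add_distrib]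
    refine Finset.sum_congr rfl fun i _ => ?_
    obtain ⟨m, hm⟩ : ∃ m, D (4 + i) = m + 1 :=
      ⟨D (4 + i) - 1, by have := h.three_le (show 4 ≤ 4 + i by omega); omega⟩
    rw [hm, choose_two_succ, Nat.add_sub_cancel]
    ring
  simp only [show Nat.choose 0 2 = 0 from rfl, show Nat.choose 1 2 = 0 from rfl,
    show Nat.choose 2 2 = 1 from rfl]
  omega

end Existence

/-! ### The run of the algorithm -/

section Run

/-- The state reached after adding all ears of types A and B, `e` ears of type E and `f` ears of
type F. -/
def IsCompressedState (a b e f : ℕ) (s : State) : Prop :=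
  ∃ D p, Profile a b e D p ∧ IsCompressedComplex a b e f D s.complex ∧
    IsCompressedMonomials a b e f D s.monomials

theorem initialState_succ_B (b : ℕ) :
    (initialState 0 (b + 1)).complex = (initialState 0 b).complex ∪
        join (Finset.powerset {0 + b + 5}) (boundaryJoin [{1, 3}, {2, 4}]) ∧
      (initialState 0 (b + 1)).monomials = (initialState 0 b).monomials ∪
        {{b + 5}, {4, b + 5}, {b + 5, b + 5}, {4, b + 5, b + 5}} := by
  have h1 : Finset.Icc 5 (b + 1 + 4) = insert (b + 5) (Finset.Icc 5 (b + 4)) := by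
    ext; simp only [Finset.mem_Icc, Finset.mem_insert]; omega
  have h2 : ∀ b, Finset.Icc (b + 5) (b + 4) = ∅ := fun b => by simp
  simp only [initialState, h1, h2, Finset.biUnion_insert, Finset.biUnion_empty,
    Finset.union_empty, zero_add]
  exact ⟨by rw [Finset.union_assoc, Finset.union_comm (join _ _)],
    by rw [Finset.union_assoc, Finset.union_comm {{b + 5}, _, _, _}]⟩

theorem initialState_succ_A (a b : ℕ) :
    (initialState (a + 1) b).complex = (initialState a b).complex ∪
        join (Finset.powerset {a + b + 5}) (boundaryJoin [{1, 2, 3}]) ∧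
      (initialState (a + 1) b).monomials = (initialState a b).monomials ∪
        {{a + b + 5}, {a + b + 5, a + b + 5}, {a + b + 5, a + b + 5, a + b + 5}} := by
  have h1 : Finset.Icc (b + 5) (a + 1 + b + 4) =
      insert (a + b + 5) (Finset.Icc (b + 5) (a + b + 4)) := by
    ext; simp only [Finset.mem_Icc, Finset.mem_insert]; omega
  simp only [initialState, h1, Finset.biUnion_insert]
  exact ⟨by rw [Finset.union_assoc, Finset.union_assoc, Finset.union_assoc,
      Finset.union_comm (join _ _)],
    by rw [Finset.union_assoc, Finset.union_assoc, Finset.union_assoc,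
      Finset.union_comm {{a + b + 5}, _, _}]⟩

theorem initialState_zero :
    (initialState 0 0).complex = boundaryJoin [{1, 2, 3, 4}] ∧
      (initialState 0 0).monomials = {0, {4}, {4, 4}, {4, 4, 4}} := by
  simp [initialState]

theorem tetrahedron_subset_initialState (a b : ℕ) :
    boundaryJoin [{1, 2, 3, 4}] ⊆ (initialState a b).complex :=
  fun _ hF => Finset.mem_union_left _ (Finset.mem_union_left _ hF)

theorem isCompressed_initialState_zero (b : ℕ) {D : ℕ → ℕ} (h3 : ∀ j ≤ 4, D j = j - 1)
    (h4 : ∀ j, 5 ≤ j → j ≤ b + 4 → D j = 4) :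
    IsCompressedComplex 0 b 0 0 D (initialState 0 b).complex ∧
      IsCompressedMonomials 0 b 0 0 D (initialState 0 b).monomials := by
  induction b with
  | zero =>
    rw [initialState_zero.1, initialState_zero.2]
    exact ⟨IsCompressedComplex.tetrahedron h3, IsCompressedMonomials.base D⟩
  | succ b ih =>
    obtain ⟨ihC, ihM⟩ := ih fun j h5 hj => h4 j h5 (by omega)
    have hD : D (b + 5) = 4 := h4 _ (by omega) (by omega)
    rw [(initialState_succ_B b).1, (initialState_succ_B b).2]
    refine ⟨?_, ihM.cone_B hD⟩
    refine ihC.cone .B rfl (by decide) (by decide) ?_ rfl ?_ (by ring) (by decide) fun i => ?_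
    · exact subset_trans (by decide) (tetrahedron_subset_initialState 0 b)
    · intro σ hσ
      cases σ <;> first | rfl | exact absurd rfl hσ
    · rw [zero_add, hD, ← (isComplex_boundaryJoin _).mem_verts,
        show verts (boundaryJoin [{1, 3}, {2, 4}]) = {1, 2, 3, 4} by decide]
      simp only [Finset.mem_insert, Finset.mem_singleton]
      omega

theorem isCompressed_initialState (a b : ℕ) :
    IsCompressedComplex a b 0 0 (baseDeg b) (initialState a b).complex ∧
      IsCompressedMonomials a b 0 0 (baseDeg b) (initialState a b).monomials := by
  induction a with
  | zero =>
    refine isCompressed_initialState_zero b (fun j hj => ?_) fun j h5 hj => ?_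
    · rw [baseDeg, if_pos hj]
    · rw [baseDeg, if_neg (by omega), if_pos hj]
  | succ a ih =>
    obtain ⟨ihC, ihM⟩ := ih
    have hD : baseDeg b (a + b + 5) = 3 := by
      rw [baseDeg, if_neg (by omega), if_neg (by omega)]
    rw [(initialState_succ_A a b).1, (initialState_succ_A a b).2]
    refine ⟨?_, ihM.cone_A hD⟩
    refine ihC.cone .A rfl (by decide) (by decide) ?_ rfl ?_ (by ring) (by decide) fun i => ?_
    · exact subset_trans (by decide) (tetrahedron_subset_initialState a b)
    · intro σ hσ
      cases σ <;> first | rfl | exact absurd rfl hσ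
    · rw [hD, ← (isComplex_boundaryJoin _).mem_verts,
        show verts (boundaryJoin [{1, 2, 3}]) = {1, 2, 3} by decide]
      simp only [Finset.mem_insert, Finset.mem_singleton]
      omega

theorem isCompressedState_initialState (a b : ℕ) :
    IsCompressedState a b 0 0 (initialState a b) :=
  ⟨_, _, profile_baseDeg a b, isCompressed_initialState a b⟩

theorem IsCompressedState.exists_eStep {a b e : ℕ} {s : State} (h : IsCompressedState a b e 0 s)
    (he : 6 + 3 * a + 4 * b + e < (4 + a + b).choose 2) :
    ∃ s', EStep s s' ∧ IsCompressedState a b (e + 1) 0 s' := by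
  obtain ⟨D, p, hD, hC, hM⟩ := h
  obtain ⟨j₀, hj₀, hlt⟩ := hD.exists_lt he
  obtain ⟨G, hG⟩ := exists_isLeastMissingFace (C := s.complex) le_rfl
    ⟨{D j₀ + 1, j₀}, Finset.card_pair (by omega),
      (hC.isMissingFace_pair_iff (by omega)).2 ⟨by omega, by omega, hj₀⟩⟩
  obtain ⟨i, j, hij, rfl⟩ : ∃ i j, i < j ∧ G = {i, j} := by
    obtain ⟨i, j, hne, rfl⟩ := Finset.card_eq_two.1 hG.1.1
    rcases hne.lt_or_gt with hlt | hlt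
    · exact ⟨i, j, hlt, rfl⟩
    · exact ⟨j, i, hlt, Finset.pair_comm i j⟩
  obtain ⟨hi1, hDi, hjn⟩ := (hC.isMissingFace_pair_iff hij).1 hG.1.2
  have hmin : ∀ k l, k < l → D l < k → 1 ≤ k → l ≤ a + b + 4 →
      (j < l ∨ j = l ∧ i < k) ∨ k = i ∧ l = j := by
    intro k l hkl hk h1 hl
    by_cases hne : ({k, l} : Finset ℕ) = {i, j}
    · have h2 : k ∈ ({i, j} : Finset ℕ) := by rw [← hne]; simp
      have h3 : l ∈ ({i, j} : Finset ℕ) := by rw [← hne]; simp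
      simp only [Finset.mem_insert, Finset.mem_singleton] at h2 h3
      omega
    · exact .inl (RevlexLT.of_pair hij hkl (hG.2 {k, l} (Finset.card_pair hkl.ne)
        ((hC.isMissingFace_pair_iff hkl).2 ⟨h1, hk, hl⟩) hne))
  -- The pair D j + 1, j is also a missing edge, so minimality leaves no gap after the neighbors of
  -- v_j.
  have hi : i = D j + 1 := by
    have := hmin (D j + 1) j (by omega) (by omega) (by omega) hjn
    omega
  -- An unsaturated earlier vertex would give a missing edge with a smaller larger endpoint.
  have hbelow : ∀ k < j, D k = k - 1 := by
    intro k hk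
    by_contra hne
    have h1 := hD.le_pred k
    have := hmin (D k + 1) k (by omega) (by omega) (by omega) (by omega)
    omega
  have h4 : 4 ≤ j := by
    by_contra hc
    have := hD.four_le
    have := hD.below j (by omega)
    omega
  have hDj := hD.three_le h4
  have hDi := hD.three_le (show 4 ≤ i by omega)
  refine ⟨⟨s.complex ∪ join (Finset.powerset {i, j}) (boundaryJoin [{1, 2}]),
    s.monomials ∪ {{i, j}, {i, i, j}}⟩, ⟨i, j, hij, hG, rfl, rfl⟩, Function.update D j (D j + 1), j,
    hD.update hjn (by omega) hbelow, hC.add_edge hij hi hjn (by omega) (by omega),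
    hM.add_edge hij hi (by omega) hjn⟩

/-- One inequality serves both halves of the step: the number of graph triangles exceeds the number
of triangular faces, and subtracting the constant of `Profile.sum_choose_eq` turns this into the
same excess for cubics. -/
theorem IsCompressedState.exists_fStep {a b e f : ℕ} {s : State} (h : IsCompressedState a b e f s)
    (h1 : 4 + 3 * a + 4 * b + 2 * e + f < 4 + 3 * a + 6 * b + 4 * e + kkTri e)
    (h2 : 4 + 3 * a + 4 * b + 2 * e + f <
      4 + 3 * a + 3 * b + 3 * (b + e) + kkTri (b + e)) :
    ∃ s', FStep s s' ∧ IsCompressedState a b e (f + 1) s' := by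
  obtain ⟨D, p, hD, hC, hM⟩ := h
  have hsum := hD.le_sum_choose (N := 4 + 3 * a + 4 * b + 2 * e + f + 1) h1 h2
  have hf : fNum s.complex 3 = 4 + 3 * a + 4 * b + 2 * e + f := hC.ears.fNum_eq.2.2.2
  obtain ⟨G, hG⟩ := exists_isLeastMissingFace (by norm_num : 2 ≤ 3)
    (hC.exists_missing_triangle hD (by omega))
  rw [hD.sum_choose_eq] at hsum
  have hm := hM.deg_three
  obtain ⟨μ, hμ⟩ := exists_isLeastAvailable (by norm_num : 2 ≤ 3)
    (hM.exists_available hD (by omega))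
  exact ⟨⟨insert G s.complex, insert μ s.monomials⟩, ⟨G, μ, hG, hμ, rfl, rfl⟩, D, p, hD,
    hC.add_triangle hG.1.1 hG.1.2, hM.add_cubic hμ.1.1 hμ.1.2⟩

/-- The algorithm succeeds whenever its input is the vector of ear numbers of some complex. -/
theorem HasEars.exists_output {V : Type*} [DecidableEq V] {Δ : Finset (Finset V)}
    {η : EarType → ℕ} (h : HasEars Δ η) :
    ∃ s, IsCompressedState (η .A) (η .B) (η .E) (η .F) s ∧ IsOutput η s ∧
      ∀ s', IsOutput η s' → s' = s := by
  obtain ⟨b1, b2, b3⟩ := h.bounds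
  obtain ⟨u, hu, hiu, huniq⟩ := exists_iterate (R := EStep) (fun _ _ _ => EStep.eq)
    (Inv := fun k => IsCompressedState (η .A) (η .B) k 0) (N := η .E)
    (isCompressedState_initialState (η .A) (η .B))
    fun k hk v hv => hv.exists_eStep (by omega)
  obtain ⟨s, hs, his, hsuniq⟩ := exists_iterate (R := FStep) (fun _ _ _ => FStep.eq)
    (Inv := fun k => IsCompressedState (η .A) (η .B) (η .E) k) (N := η .F) hu
    fun k hk v hv => hv.exists_fStep (by omega) (by omega)
  refine ⟨s, hs, ⟨u, hiu, his⟩, ?_⟩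
  rintro s' ⟨u', hu', hs'⟩
  obtain rfl := huniq u' hu'
  exact hsuniq s' hs'

end Run

end PSEar

/-! ### The main theorem -/

theorem theorem3p2 {V : Type*} [DecidableEq V] (Δ : Finset (Finset V)) (t : ℕ)
    (P : ℕ → Finset (Finset V)) (hP : PSEar.IsPSEarDecomposition 3 Δ t P)
    (h0 : PSEar.IsSphereOfType [3] (P 0)) :
    (∃! s, PSEar.IsOutput (PSEar.earCount t P) s) ∧
    (∀ s, PSEar.IsOutput (PSEar.earCount t P) s →
      (∃ Q : ℕ → Finset (Finset ℕ), PSEar.IsPSEarDecomposition 3 s.complex t Q ∧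
        PSEar.IsSphereOfType [3] (Q 0) ∧ PSEar.earCount t Q = PSEar.earCount t P) ∧
      PSEar.IsPureMulticomplex s.monomials ∧
      PSEar.FVector s.monomials = PSEar.hVector s.complex ∧
      PSEar.hVector s.complex = PSEar.hVector Δ) ∧
    PSEar.IsPureOSequence (PSEar.hVector Δ) := by
  have hE : PSEar.HasEars Δ (PSEar.earCount t P) := ⟨t, P, hP, h0, rfl⟩
  obtain ⟨T, hT⟩ := hP.tetrahedral h0
  have ht := hT.sum_earCount
  obtain ⟨s, ⟨D, p, -, hC, hM⟩, hs, huniq⟩ := hE.exists_output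
  have hcounts : PSEar.counts (PSEar.earCount t P .A) (PSEar.earCount t P .B)
      (PSEar.earCount t P .E) (PSEar.earCount t P .F) = PSEar.earCount t P := by
    funext τ
    cases τ <;> rfl
  have hC' := hC.ears
  rw [hcounts] at hC'
  have hF : PSEar.FVector s.monomials = PSEar.hVector Δ := by
    rw [hM.fVector, hE.hVector_eq]
  have hH : PSEar.hVector s.complex = PSEar.hVector Δ := by
    rw [hC'.hVector_eq, hE.hVector_eq]
  refine ⟨⟨s, hs, huniq⟩, ?_, s.monomials, hM.isPureMulticomplex, hF⟩
  intro s' hs'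
  obtain rfl := huniq s' hs'
  obtain ⟨Q, hQ⟩ := hC'.exists_decomposition
  rw [← ht] at hQ
  exact ⟨⟨Q, hQ⟩, hM.isPureMulticomplex, hF.trans hH.symm, hH⟩
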